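/- Consider marriage markets with $n$ women and $n$ men, in which every participant has a full preference list, i.e. a total order on the members of the other side. A marriage is a bijection $\mu$ between women and men; it is stable if no woman and man prefer each other over their spouses in $\mu$. For marriages $\mu,\mu'$ let $d(\mu,\mu')=n-|\mu\cap\mu'|$, where $\mu\cap\mu'$ is the set of couples married in both, and let $d(\mu)$ be the minimum of $d(\mu,\mu')$ over all stable marriages $\mu'$. The marriage $\mu$ is called $(1-\varepsilon)$-stable if $d(\mu)\le\varepsilon n$, and $\varepsilon$-unstable if $d(\mu)>\varepsilon n$. A deterministic algorithm adaptively makes Boolean queries, each of which is an arbitrary Boolean function either of the profile of all women's preferences or of the profile of all men's preferences, and then produces an output. It solves a task if its output is correct on every input. A randomized algorithm is a probability distribution over deterministic ones. Fix a probability $p$ with $\tfrac12<p\le1$ (for instance $p=\tfrac23$); a randomized algorithm solves a task if on every input its output is correct with probability at least $p$. The number of queries in the worst case is the maximum over all inputs and, for a randomized algorithm, over all its random choices. Theorem 8. Any randomized or deterministic algorithm that solves one of the following tasks requires $\Omega(n^2)$ queries in the worst case, i.e. at least $c\,n^2$ queries for all sufficiently large $n$, where $c>0$ and the threshold for $n$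 depend only on $p$ and, in (a), (b) and (d), on $\varepsilon$: (a) finding a $(1-\varepsilon)$-stable marriage, for fixed $\varepsilon$ with $0\le\varepsilon<\tfrac12$; (b) determining whether a given marriage $\mu$ is stable or $\varepsilon$-unstable, when it is promised to be one of the two, for fixed $\varepsilon$ with $0\le\varepsilon<1$ (the bound holds for every fixed $\mu$, known to the algorithm in advance); (c) deciding whether a given pair $(w,m)$ is contained in some stable marriage, and, likewise, deciding whether it is contained in every stable marriage (the bounds hold for every fixed pair, known to the algorithm in advance); (d) finding at least $\varepsilon n$ pairs each of which appears in some stable marriage, and, likewise, finding at least $\varepsilon n$ pairs each of which appears in every stable marriage, for fixed $\varepsilon$ with $0<\varepsilon\le1$ (where a correct output is required only on inputs that admit one). -/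

import Mathlib

namespace StableMarriage

/-! ## Marriage markets with full preference lists

There are `n` women and `n` men, each side labelled by `Fin n`. -/

/-- A profile of full preference lists of one side of the market over the other side.
The total order of participant `a` is recorded by ranks: `P a b` is the place of `b` on the list
of `a`, the place `0` being the most preferred. -/
abbrev Profile (n : ℕ) : Type := Fin n → (Fin n ≃ Fin n)

/-- A perfect marriage; `μ w` is the husband of the woman `w`, and `μ.symm m` the wife of the
man `m`. -/
abbrev Marriage (n : ℕ) : Type := Fin n ≃ Fin n

/-- Participant `a` prefers `b` over `b'`. -/
def Prefers {n : ℕ} (P : Profile n) (a b b' : Fin n) : Prop := P a b < P a b'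

/-- The pair of the woman `w` and the man `m` is blocking with respect to `μ`. -/
def IsBlocking {n : ℕ} (PW PM : Profile n) (μ : Marriage n) (w m : Fin n) : Prop :=
  Prefers PW w m (μ w) ∧ Prefers PM m w (μ.symm m)

/-- The marriage `μ` is stable. -/
def IsStable {n : ℕ} (PW PM : Profile n) (μ : Marriage n) : Prop :=
  ∀ w m : Fin n, ¬ IsBlocking PW PM μ w m

/-- The divorce distance: `n` minus the number of couples that are married in both marriages
(that number is at most `n`, so the subtraction does not truncate). -/
def divorceDist {n : ℕ} (μ μ' : Marriage n) : ℕ :=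
  n - (Finset.univ.filter (fun w : Fin n => μ w = μ' w)).card

/-- The divorce distance to stability: the least divorce distance to a stable marriage.
Every market with full preference lists has a stable marriage, so this is a minimum over a
nonempty set. -/
noncomputable def distToStability {n : ℕ} (PW PM : Profile n) (μ : Marriage n) : ℕ :=
  sInf {k : ℕ | ∃ μ' : Marriage n, IsStable PW PM μ' ∧ divorceDist μ μ' = k}

/-- `μ` is `(1 - ε)`-stable. -/
def IsApproxStable {n : ℕ} (ε : ℝ) (PW PM : Profile n) (μ : Marriage n) : Prop :=
  (distToStability PW PM μ : ℝ) ≤ ε * n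

/-- `μ` is `ε`-unstable. -/
def IsUnstable {n : ℕ} (ε : ℝ) (PW PM : Profile n) (μ : Marriage n) : Prop :=
  ε * n < (distToStability PW PM μ : ℝ)

/-- The pair `(w, m)` is married in some stable marriage. -/
def InSomeStable {n : ℕ} (PW PM : Profile n) (w m : Fin n) : Prop :=
  ∃ μ : Marriage n, IsStable PW PM μ ∧ μ w = m

/-- The pair `(w, m)` is married in every stable marriage. -/
def InEveryStable {n : ℕ} (PW PM : Profile n) (w m : Fin n) : Prop :=
  ∀ μ : Marriage n, IsStable PW PM μ → μ w = m

/-! ## Query algorithms -/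

/-- A deterministic adaptive algorithm with outputs in `O` that makes arbitrary Boolean queries:
each query is an arbitrary Boolean function either of the women's profile alone or of the men's
profile alone, and the continuation depends on the answer. -/
inductive QueryAlg (n : ℕ) (O : Type) : Type
  | output (o : O) : QueryAlg n O
  | askWomen (q : Profile n → Bool) (ifTrue ifFalse : QueryAlg n O) : QueryAlg n O
  | askMen (q : Profile n → Bool) (ifTrue ifFalse : QueryAlg n O) : QueryAlg n O

/-- The output of the algorithm on the market with profiles `PW` and `PM`. -/
def QueryAlg.run {n : ℕ} {O : Type} (PW PM : Profile n) : QueryAlg n O → O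
  | .output o => o
  | .askWomen q t f => if q PW = true then t.run PW PM else f.run PW PM
  | .askMen q t f => if q PM = true then t.run PW PM else f.run PW PM

/-- The number of queries that the algorithm makes on the market with profiles `PW` and `PM`. -/
def QueryAlg.numQueries {n : ℕ} {O : Type} (PW PM : Profile n) : QueryAlg n O → ℕ
  | .output _ => 0
  | .askWomen q t f => 1 + if q PW = true then t.numQueries PW PM else f.numQueries PW PM
  | .askMen q t f => 1 + if q PM = true then t.numQueries PW PM else f.numQueries PW PM

/-- A computational task: which outputs are correct for the market with given women's and men's
profiles. -/
abbrev Task (n : ℕ) (O : Type) : Type := Profile n → Profile n → O → Prop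

/-- The deterministic algorithm `A` solves the task `T`. -/
def Solves {n : ℕ} {O : Type} (T : Task n O) (A : QueryAlg n O) : Prop :=
  ∀ PW PM : Profile n, T PW PM (A.run PW PM)

/-- A randomized algorithm is a probability distribution over deterministic ones. It solves the
task `T` with success probability `p` if, on every input, its output is correct with probability
at least `p`. -/
def SolvesWithProb {n : ℕ} {O : Type} (p : ℝ) (T : Task n O) (D : PMF (QueryAlg n O)) : Prop :=
  ∀ PW PM : Profile n,
    ENNReal.ofReal p ≤ D.toOuterMeasure {A : QueryAlg n O | T PW PM (A.run PW PM)}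

/-- The task `T` requires at least `b` queries in the worst case, both for every deterministic
algorithm that solves it (worst case over the inputs) and for every randomized algorithm that
solves it with success probability `p` (worst case over the inputs and the random choices). -/
def RequiresQueries {n : ℕ} {O : Type} (p : ℝ) (T : Task n O) (b : ℝ) : Prop :=
  (∀ A : QueryAlg n O, Solves T A →
    ∃ PW PM : Profile n, b ≤ (A.numQueries PW PM : ℝ)) ∧
  (∀ D : PMF (QueryAlg n O), SolvesWithProb p T D →
    ∃ A ∈ D.support, ∃ PW PM : Profile n, b ≤ (A.numQueries PW PM : ℝ))

/-! ## The tasks -/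

/-- Find a `(1 - ε)`-stable marriage. -/
def findApproxStable (n : ℕ) (ε : ℝ) : Task n (Marriage n) :=
  fun PW PM μ => IsApproxStable ε PW PM μ

/-- Determine whether the given marriage `μ` is stable (answer `true`) or `ε`-unstable (answer
`false`); there is no requirement if it is neither. -/
def distinguishStable {n : ℕ} (ε : ℝ) (μ : Marriage n) : Task n Bool :=
  fun PW PM a =>
    (IsStable PW PM μ → a = true) ∧ (IsUnstable ε PW PM μ → a = false)

/-- Decide whether the given pair is contained in some stable marriage. -/
def decideInSome {n : ℕ} (w m : Fin n) : Task n Bool :=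
  fun PW PM a => a = true ↔ InSomeStable PW PM w m

/-- Decide whether the given pair is contained in every stable marriage. -/
def decideInEvery {n : ℕ} (w m : Fin n) : Task n Bool :=
  fun PW PM a => a = true ↔ InEveryStable PW PM w m

/-- `S` consists of at least `ε n` pairs `(w, m)`, all of which satisfy `R`. -/
def IsPairList {n : ℕ} (ε : ℝ) (R : Fin n → Fin n → Prop) (S : Finset (Fin n × Fin n)) : Prop :=
  ε * n ≤ (S.card : ℝ) ∧ ∀ q ∈ S, R q.1 q.2

/-- Find `ε n` pairs each of which appears in some stable marriage; there is no requirement on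
inputs without that many such pairs. -/
def findPairsInSome (n : ℕ) (ε : ℝ) : Task n (Finset (Fin n × Fin n)) :=
  fun PW PM S =>
    (∃ S', IsPairList ε (InSomeStable PW PM) S') → IsPairList ε (InSomeStable PW PM) S

/-- Find `ε n` pairs each of which appears in every stable marriage; there is no requirement on
inputs without that many such pairs. -/
def findPairsInEvery (n : ℕ) (ε : ℝ) : Task n (Finset (Fin n × Fin n)) :=
  fun PW PM S =>
    (∃ S', IsPairList ε (InEveryStable PW PM) S') → IsPairList ε (InEveryStable PW PM) S

end StableMarriage

open StableMarriage

/-! The tasks are hard because unique disjointness of subsets of a `k × k` grid embeds into markets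
with `k` proportional to `n`. The women know one set, the men the other. If the sets are disjoint, a
prescribed `μ` is the only stable marriage. If they meet in one pair, that couple marries, the
deserted wife displaces the next woman, and a chain of displacements through the rest of the market
makes the only stable marriage agree with `μ` on at most `2 * k` couples. A correct output for each
task tells the two cases apart (`requiresQueries_of_separates`).

The lower bound for unique disjointness is analytic. At most `B` queries cut the inputs into at most
`2 ^ B` rectangles, so the probability of reaching a leaf `l` is a product of a function `a l` of
one set and a function `b l` of the other. A random partition `D` decides which side may hold each
coordinate, so the random sets are independent and disjoint. The level-one inequality
`sum_bias_sq_le` bounds the correlations of `a l` and `b l` with all coordinates together; weighted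
and summed over the leaves, these bounds add up to the entropy of the leaf, at most `B * log 2` up
to a factor (`sum_revealed_le`). Hence an average coordinate is revealed only to the extent `B / k ^
2`.

For one coordinate, the cut-and-paste property of product distributions
(`sq_advantage_le_of_products`) turns this into closeness of the leaf distributions for an
intersection there and for none. With few queries the advantage is too small for success probability
`p > 1 / 2`; averaging over the random choices transfers this to randomized algorithms. -/

namespace StableMarriage

open Finset Function
open scoped BigOperators

/-! ### The hard distribution for unique disjointness. -/

section Inputs

variable {ι : Type*} [DecidableEq ι]

/-- The set of the elements `i` of `u` with `D i = c`. -/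
def mask (c : Bool) (D u : ι → Bool) : ι → Bool := fun i => (D i == c) && u i

theorem mask_update (c : Bool) (D u : ι → Bool) (j : ι) (s : Bool) (h : D j = c) :
    mask c D (update u j s) = update (mask c D u) j s := by
  ext i; by_cases hi : i = j
  · subst hi; simp [mask, h]
  · simp [mask, hi]

theorem mask_eq_update (c : Bool) (D u : ι → Bool) (j : ι) (h : D j ≠ c) :
    mask c D u = update (mask c D u) j false := by
  ext i; by_cases hi : i = j
  · subst hi; simp [mask, h]
  · simp [hi]

theorem update_mask_update (c : Bool) (D u : ι → Bool) (j : ι) (s t : Bool) :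
    update (mask c (update D j t) u) j s = update (mask c D u) j s := by
  ext i; by_cases hi : i = j
  · subst hi; simp
  · simp [mask, hi]

/-- The points from which the hard inputs of unique disjointness are made: a coordinate, a
partition of the coordinates, and a random set for each side. -/
abbrev Seed (ι : Type*) : Type _ := ι × (ι → Bool) × (ι → Bool) × (ι → Bool)

/-- The first set of the instance with value `s` at the distinguished coordinate. -/
def Seed.fst (s : Bool) (ω : Seed ι) : ι → Bool := update (mask true ω.2.1 ω.2.2.1) ω.1 s

/-- The second set of the instance with value `s` at the distinguished coordinate. -/
def Seed.snd (s : Bool) (ω : Seed ι) : ι → Bool := update (mask false ω.2.1 ω.2.2.2) ω.1 s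

theorem Seed.disjoint (ω : Seed ι) (i : ι) :
    ¬ (Seed.fst false ω i = true ∧ Seed.snd false ω i = true) := by
  by_cases hi : i = ω.1
  · subst hi; simp [Seed.fst]
  · cases h : ω.2.1 i <;> simp [Seed.fst, Seed.snd, hi, mask, h]

theorem Seed.fst_inter_snd (ω : Seed ι) (i : ι) :
    (Seed.fst true ω i = true ∧ Seed.snd true ω i = true) ↔ i = ω.1 := by
  by_cases hi : i = ω.1
  · subst hi; simp [Seed.fst, Seed.snd]
  · cases h : ω.2.1 i <;> simp [Seed.fst, Seed.snd, hi, mask, h]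

end Inputs

/-! ### The level-one inequality and the entropy bound. -/

section Disjointness

variable {ι L : Type*} [Fintype ι] [DecidableEq ι] [Fintype L]

/-- The sign of a bit. -/
def sign (b : Bool) : ℝ := if b then 1 else -1

/-- The correlation of a function on the Boolean cube with the sign of the coordinate `j`. -/
noncomputable def bias (F : (ι → Bool) → ℝ) (j : ι) : ℝ := 𝔼 u, sign (u j) * F u

/-- The coordinates are independent, so the mean factors into hyperbolic cosines, and `cosh t ≤ exp
(t ^ 2 / 2)`. -/
theorem expect_exp_sign_le (v : ι → ℝ) :
    𝔼 u : ι → Bool, Real.exp (∑ j, v j * sign (u j)) ≤ Real.exp ((∑ j, v j ^ 2) / 2) := by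
  have h : ∑ u : ι → Bool, Real.exp (∑ j, v j * sign (u j)) = ∏ j, (2 * Real.cosh (v j)) := by
    simp_rw [Real.exp_sum]
    rw [← Fintype.prod_sum (fun j (b : Bool) => Real.exp (v j * sign b))]
    refine prod_congr rfl fun j _ => ?_
    simp [sign, Real.cosh_eq]
    ring
  rw [Fintype.expect_eq_sum_div_card, h, prod_mul_distrib, sum_div, Real.exp_sum]
  simp only [prod_const, Fintype.card_fun, Fintype.card_bool, card_univ, Nat.cast_pow,
    Nat.cast_ofNat]
  rw [mul_div_cancel_left₀ _ (by positivity)]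
  exact prod_le_prod (fun j _ => (Real.cosh_pos _).le) fun j _ => Real.cosh_le_exp_half_sq _

/-- The level-one inequality on the Boolean cube. -/
theorem sum_bias_sq_le (F : (ι → Bool) → ℝ) (h0 : ∀ u, 0 ≤ F u) (h1 : ∀ u, F u ≤ 1) :
    ∑ j, bias F j ^ 2 ≤ 2 * (𝔼 u, F u) ^ 2 * -Real.log (𝔼 u, F u) := by
  set A := 𝔼 u, F u with hA
  have hA0 : 0 ≤ A := expect_nonneg fun u _ => h0 u
  rcases hA0.eq_or_lt with hz | hpos
  · have hF : F = 0 := (Fintype.expect_eq_zero_iff_of_nonneg (f := F) h0).1 hz.symm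
    simp [bias, hF, ← hz]
  set v : ι → ℝ := fun j => bias F j / A with hv
  set s := ∑ j, v j ^ 2 with hs
  set z : (ι → Bool) → ℝ := fun u => ∑ j, v j * sign (u j) with hzdef
  have hFz : 𝔼 u, F u * z u = s * A := by
    simp_rw [hzdef, mul_sum]
    rw [expect_sum_comm, hs, sum_mul]
    refine sum_congr rfl fun j _ => ?_
    have : ∀ u : ι → Bool, F u * (v j * sign (u j)) = v j * (sign (u j) * F u) := fun u => by ring
    simp_rw [this]
    rw [← mul_expect]
    change v j * bias F j = _
    simp only [hv]
    field_simp
  -- The tangent to `exp` at `s` lies below `exp`. Averaged against `F`, its linear part cancels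
  -- because the `F`-weighted mean of `z` is `s`.
  have key : Real.exp s * A ≤ Real.exp (s / 2) := by
    calc Real.exp s * A = 𝔼 u, F u * (Real.exp s * (1 + z u - s)) := by
          have : ∀ u, F u * (Real.exp s * (1 + z u - s))
              = Real.exp s * (F u * z u) + Real.exp s * (1 - s) * F u := fun u => by ring
          simp_rw [this]
          rw [expect_add_distrib, ← mul_expect, ← mul_expect, hFz, ← hA]
          ring
      _ ≤ 𝔼 u, Real.exp (z u) := by
          refine expect_le_expect fun u _ => ?_
          have e1 : Real.exp s * (1 + z u - s) ≤ Real.exp (z u) := by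
            have := Real.add_one_le_exp (z u - s)
            calc Real.exp s * (1 + z u - s) ≤ Real.exp s * Real.exp (z u - s) := by
                  gcongr; linarith
              _ = Real.exp (z u) := by rw [← Real.exp_add]; congr 1; ring
          calc F u * (Real.exp s * (1 + z u - s)) ≤ F u * Real.exp (z u) := by
                gcongr; exact h0 u
            _ ≤ 1 * Real.exp (z u) := by gcongr; exact h1 u
            _ = _ := one_mul _
      _ ≤ Real.exp (s / 2) := expect_exp_sign_le v
  have hlog : s ≤ 2 * -Real.log A := by
    have := Real.log_le_log (by positivity) key
    rw [Real.log_mul (Real.exp_pos _).ne' hpos.ne', Real.log_exp, Real.log_exp] at this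
    linarith
  have hsum : ∑ j, bias F j ^ 2 = A ^ 2 * s := by
    rw [hs, mul_sum]
    refine sum_congr rfl fun j _ => ?_
    simp only [hv]
    field_simp
  rw [hsum]
  nlinarith [mul_le_mul_of_nonneg_left hlog (sq_nonneg A)]

/-- The entropy of a distribution on `L` is at most `log |L|`. -/
theorem sum_negMulLog_le (δ : L → ℝ) (h0 : ∀ l, 0 ≤ δ l) (h1 : ∑ l, δ l = 1) :
    ∑ l, Real.negMulLog (δ l) ≤ Real.log (Fintype.card L) := by
  have hne : Nonempty L := by
    by_contra h
    rw [not_nonempty_iff] at h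
    simp at h1
  have hM : (0 : ℝ) < Fintype.card L := by exact_mod_cast Fintype.card_pos
  set M : ℝ := (Fintype.card L : ℝ) with hMdef
  -- Comparison with the uniform distribution through `log t ≤ t - 1`; the corrections `1 / M - δ l`
  -- sum to zero.
  have hterm : ∀ l, Real.negMulLog (δ l) ≤ δ l * Real.log M + (1 / M - δ l) := by
    intro l
    rcases (h0 l).eq_or_lt with hz | hpos
    · rw [← hz]; simp [hM.le]
    · have := Real.log_le_sub_one_of_pos (x := 1 / (δ l * M)) (by positivity)
      rw [one_div, Real.log_inv, Real.log_mul hpos.ne' hM.ne'] at this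
      have h2 := mul_le_mul_of_nonneg_left this hpos.le
      have h3 : δ l * ((δ l * M)⁻¹ - 1) = 1 / M - δ l := by field_simp
      rw [h3] at h2
      rw [Real.negMulLog]
      linarith
  calc ∑ l, Real.negMulLog (δ l) ≤ ∑ l, (δ l * Real.log M + (1 / M - δ l)) :=
        sum_le_sum fun l _ => hterm l
    _ = Real.log M := by
        rw [sum_add_distrib, ← sum_mul, h1, sum_sub_distrib, h1]
        simp only [sum_const, card_univ, nsmul_eq_mul, ← hMdef]
        field_simp
        ring

/-! ### Conditioning on one coordinate, and the information revealed about it. -/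

theorem expect_cube_split (j : ι) (h : (ι → Bool) → ℝ) :
    𝔼 u, h u = (𝔼 u, h (update u j true) + 𝔼 u, h (update u j false)) / 2 := by
  let flip : (ι → Bool) ≃ (ι → Bool) :=
    Function.Involutive.toPerm (fun u => update u j (!u j)) fun u => by
      ext i; by_cases hi : i = j
      · subst hi; simp
      · simp [hi]
  have h1 : 𝔼 u, h u = 𝔼 u, h (flip u) := (Fintype.expect_equiv flip _ _ fun u => rfl).symm
  have h2 : 𝔼 u, h u + 𝔼 u, h (flip u)
      = 𝔼 u, h (update u j true) + 𝔼 u, h (update u j false) := by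
    rw [← expect_add_distrib, ← expect_add_distrib]
    refine expect_congr rfl fun u _ => ?_
    change h u + h (update u j (!u j)) = _
    cases hu : u j
    · have : update u j false = u := by rw [← hu]; exact update_eq_self j u
      simp only [Bool.not_false, this]; ring
    · have : update u j true = u := by rw [← hu]; exact update_eq_self j u
      simp only [Bool.not_true, this]
  linarith

/-- The mean of `f` over the masked points whose coordinate `j` is replaced by `s`. -/
noncomputable def fixMean (f : (ι → Bool) → ℝ) (c : Bool) (D : ι → Bool) (j : ι) (s : Bool) : ℝ :=
  𝔼 u, f (update (mask c D u) j s)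

theorem fixMean_update (f : (ι → Bool) → ℝ) (c : Bool) (D : ι → Bool) (j : ι) (s t : Bool) :
    fixMean f c (update D j t) j s = fixMean f c D j s := by
  simp only [fixMean, update_mask_update]

theorem expect_mask_of_eq (f : (ι → Bool) → ℝ) (c : Bool) (D : ι → Bool) (j : ι) (h : D j = c) :
    𝔼 u, f (mask c D u) = (fixMean f c D j true + fixMean f c D j false) / 2 := by
  rw [expect_cube_split j fun u => f (mask c D u)]
  simp only [mask_update c D _ j _ h, fixMean]

theorem expect_mask_of_ne (f : (ι → Bool) → ℝ) (c : Bool) (D : ι → Bool) (j : ι) (h : D j ≠ c) :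
    𝔼 u, f (mask c D u) = fixMean f c D j false := by
  unfold fixMean
  exact expect_congr rfl fun u _ => by rw [← mask_eq_update c D u j h]

theorem bias_mask_of_eq (f : (ι → Bool) → ℝ) (c : Bool) (D : ι → Bool) (j : ι) (h : D j = c) :
    bias (fun u => f (mask c D u)) j = (fixMean f c D j true - fixMean f c D j false) / 2 := by
  unfold bias
  rw [expect_cube_split j fun u => sign (u j) * f (mask c D u)]
  simp only [mask_update c D _ j _ h, fixMean, update_self, sign, if_true, one_mul, neg_mul,
    Bool.false_eq_true, if_false, expect_neg_distrib, sub_eq_add_neg]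

/-- The information about the coordinate `j` that is revealed, given `D`. -/
noncomputable def revealed (a b : L → (ι → Bool) → ℝ) (D : ι → Bool) (j : ι) : ℝ :=
  ∑ l, (bias (fun u => a l (mask true D u)) j ^ 2
          * ((𝔼 v, b l (mask false D v)) / 𝔼 u, a l (mask true D u))
      + bias (fun v => b l (mask false D v)) j ^ 2
          * ((𝔼 u, a l (mask true D u)) / 𝔼 v, b l (mask false D v)))

/-- The weights `B / A` and `A / B` in `revealed` are chosen so that the two level-one bounds
combine into the entropy term of the leaf probability `A * B`. A zero factor makes both sides
vanish, under the convention for division by zero. -/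
theorem mul_neg_log_add (A B : ℝ) (hA : 0 ≤ A) (hB : 0 ≤ B) :
    2 * A ^ 2 * -Real.log A * (B / A) + 2 * B ^ 2 * -Real.log B * (A / B)
      = 2 * Real.negMulLog (A * B) := by
  rcases hA.eq_or_lt with hz | hA
  · rw [← hz]; simp
  rcases hB.eq_or_lt with hz | hB
  · rw [← hz]; simp
  rw [Real.negMulLog, Real.log_mul hA.ne' hB.ne']
  field_simp
  ring

variable {a b : L → (ι → Bool) → ℝ}

/-- For fixed `D` the two masked sets are independent, so the products of means form a distribution
on the leaves. The level-one inequality on each side leaves twice its entropy. -/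
theorem sum_revealed_le
    (ha0 : ∀ l x, 0 ≤ a l x) (ha1 : ∀ l x, a l x ≤ 1)
    (hb0 : ∀ l y, 0 ≤ b l y) (hb1 : ∀ l y, b l y ≤ 1)
    (hab : ∀ x y, ∑ l, a l x * b l y = 1) (D : ι → Bool) :
    ∑ j, revealed a b D j ≤ 2 * Real.log (Fintype.card L) := by
  unfold revealed
  rw [sum_comm]
  have hA0 : ∀ l, 0 ≤ 𝔼 u, a l (mask true D u) := fun l => expect_nonneg fun u _ => ha0 _ _
  have hB0 : ∀ l, 0 ≤ 𝔼 v, b l (mask false D v) := fun l => expect_nonneg fun u _ => hb0 _ _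
  have hsum : ∑ l, (𝔼 u, a l (mask true D u)) * (𝔼 v, b l (mask false D v)) = 1 := by
    simp_rw [Fintype.expect_mul_expect]
    rw [← expect_sum_comm]
    simp_rw [← expect_sum_comm, hab]
    simp
  have hent := sum_negMulLog_le _ (fun l => mul_nonneg (hA0 l) (hB0 l)) hsum
  calc _ ≤ ∑ l, 2 * Real.negMulLog
          ((𝔼 u, a l (mask true D u)) * (𝔼 v, b l (mask false D v))) := by
        refine sum_le_sum fun l _ => ?_
        rw [sum_add_distrib, ← sum_mul, ← sum_mul, ← mul_neg_log_add _ _ (hA0 l) (hB0 l)]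
        refine add_le_add
          (mul_le_mul_of_nonneg_right (sum_bias_sq_le _ (fun _ => ha0 _ _) fun _ => ha1 _ _)
            (div_nonneg (hB0 l) (hA0 l)))
          (mul_le_mul_of_nonneg_right (sum_bias_sq_le _ (fun _ => hb0 _ _) fun _ => hb1 _ _)
            (div_nonneg (hA0 l) (hB0 l)))
    _ ≤ _ := by rw [← mul_sum]; linarith

/-! ### Hellinger distance and the advantage at one coordinate. -/

theorem sq_sqrt_sub_le (A₀ A₁ : ℝ) (h₀ : 0 ≤ A₀) (h₁ : 0 ≤ A₁) :
    (√A₁ - √A₀) ^ 2 ≤ 2 * (((A₁ - A₀) / 2) ^ 2 / ((A₁ + A₀) / 2)) := by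
  rcases (add_nonneg h₁ h₀).eq_or_lt with hz | hpos
  · have e1 : A₁ = 0 := by linarith
    have e0 : A₀ = 0 := by linarith
    simp [e1, e0]
  · have hs1 := Real.sq_sqrt h₁
    have hs0 := Real.sq_sqrt h₀
    have e : 2 * (((A₁ - A₀) / 2) ^ 2 / ((A₁ + A₀) / 2)) = (A₁ - A₀) ^ 2 / (A₁ + A₀) := by
      field_simp
    rw [e, le_div_iff₀ hpos]
    have hfac : (A₁ - A₀) ^ 2 = (√A₁ - √A₀) ^ 2 * (√A₁ + √A₀) ^ 2 := by
      rw [← mul_pow]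
      congr 1
      linear_combination hs0 - hs1
    rw [hfac]
    gcongr
    nlinarith [mul_nonneg (Real.sqrt_nonneg A₁) (Real.sqrt_nonneg A₀)]

/-- The cut-and-paste property of product distributions. -/
theorem sq_advantage_le_of_products (A₀ A₁ B₀ B₁ g : L → ℝ)
    (hA₀ : ∀ l, 0 ≤ A₀ l) (hA₁ : ∀ l, 0 ≤ A₁ l) (hB₀ : ∀ l, 0 ≤ B₀ l) (hB₁ : ∀ l, 0 ≤ B₁ l)
    (hg0 : ∀ l, 0 ≤ g l) (hg1 : ∀ l, g l ≤ 1)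
    (h00 : ∑ l, A₀ l * B₀ l = 1) (h01 : ∑ l, A₀ l * B₁ l = 1)
    (h10 : ∑ l, A₁ l * B₀ l = 1) (h11 : ∑ l, A₁ l * B₁ l = 1) :
    (∑ l, g l * (A₁ l * B₁ l - A₀ l * B₀ l)) ^ 2 ≤
      16 * (∑ l, ((A₁ l - A₀ l) / 2) ^ 2 * (B₀ l / ((A₁ l + A₀ l) / 2))
        + ∑ l, ((B₁ l - B₀ l) / 2) ^ 2 * (A₀ l / ((B₁ l + B₀ l) / 2))) := by
  have sA₀ := fun l => Real.sq_sqrt (hA₀ l)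
  have sA₁ := fun l => Real.sq_sqrt (hA₁ l)
  have sB₀ := fun l => Real.sq_sqrt (hB₀ l)
  have sB₁ := fun l => Real.sq_sqrt (hB₁ l)
  set α₀ : L → ℝ := fun l => √(A₀ l)
  set α₁ : L → ℝ := fun l => √(A₁ l)
  set β₀ : L → ℝ := fun l => √(B₀ l)
  set β₁ : L → ℝ := fun l => √(B₁ l)
  change ∀ l, α₀ l ^ 2 = A₀ l at sA₀
  change ∀ l, α₁ l ^ 2 = A₁ l at sA₁
  change ∀ l, β₀ l ^ 2 = B₀ l at sB₀
  change ∀ l, β₁ l ^ 2 = B₁ l at sB₁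
  have hα₀ : ∀ l, 0 ≤ α₀ l := fun l => Real.sqrt_nonneg _
  have hα₁ : ∀ l, 0 ≤ α₁ l := fun l => Real.sqrt_nonneg _
  have hβ₀ : ∀ l, 0 ≤ β₀ l := fun l => Real.sqrt_nonneg _
  have hβ₁ : ∀ l, 0 ≤ β₁ l := fun l => Real.sqrt_nonneg _
  set H := ∑ l, (α₁ l * β₁ l - α₀ l * β₀ l) ^ 2 with hH
  -- Cut and paste: both squares have the same cross term, and each of the four product
  -- distributions has total mass one.
  have hcp : H = ∑ l, (α₁ l * β₀ l - α₀ l * β₁ l) ^ 2 := by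
    have e1 : ∀ l, (α₁ l * β₁ l - α₀ l * β₀ l) ^ 2 = A₁ l * B₁ l + A₀ l * B₀ l
        - 2 * (α₁ l * β₁ l * α₀ l * β₀ l) := fun l => by
      rw [← sA₀, ← sA₁, ← sB₀, ← sB₁]; ring
    have e2 : ∀ l, (α₁ l * β₀ l - α₀ l * β₁ l) ^ 2 = A₁ l * B₀ l + A₀ l * B₁ l
        - 2 * (α₁ l * β₁ l * α₀ l * β₀ l) := fun l => by
      rw [← sA₀, ← sA₁, ← sB₀, ← sB₁]; ring
    rw [hH]
    simp_rw [e1, e2, sum_sub_distrib, sum_add_distrib, h00, h01, h10, h11]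
  have hH2 : H ≤ 4 * (∑ l, ((A₁ l - A₀ l) / 2) ^ 2 * (B₀ l / ((A₁ l + A₀ l) / 2))
        + ∑ l, ((B₁ l - B₀ l) / 2) ^ 2 * (A₀ l / ((B₁ l + B₀ l) / 2))) := by
    rw [hcp, ← sum_add_distrib, mul_sum]
    refine sum_le_sum fun l _ => ?_
    have i1 := mul_le_mul_of_nonneg_right (sq_sqrt_sub_le _ _ (hA₀ l) (hA₁ l)) (hB₀ l)
    have i2 := mul_le_mul_of_nonneg_right (sq_sqrt_sub_le _ _ (hB₀ l) (hB₁ l)) (hA₀ l)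
    change (α₁ l - α₀ l) ^ 2 * _ ≤ _ at i1
    change (β₁ l - β₀ l) ^ 2 * _ ≤ _ at i2
    have e1 : 2 * (((A₁ l - A₀ l) / 2) ^ 2 / ((A₁ l + A₀ l) / 2)) * B₀ l
        = 2 * (((A₁ l - A₀ l) / 2) ^ 2 * (B₀ l / ((A₁ l + A₀ l) / 2))) := by ring
    have e2 : 2 * (((B₁ l - B₀ l) / 2) ^ 2 / ((B₁ l + B₀ l) / 2)) * A₀ l
        = 2 * (((B₁ l - B₀ l) / 2) ^ 2 * (A₀ l / ((B₁ l + B₀ l) / 2))) := by ring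
    rw [e1, ← sB₀] at i1
    rw [e2, ← sA₀] at i2
    rw [← sB₀, ← sA₀] at *
    -- The triangle inequality through the pair of index `0, 0`: `α₁ β₀ - α₀ β₁ = (α₁ - α₀) β₀ - (β₁
    -- - β₀) α₀`, then `(r - t) ^ 2 ≤ 2 * r ^ 2 + 2 * t ^ 2`.
    nlinarith [sq_nonneg ((α₁ l - α₀ l) * β₀ l + (β₁ l - β₀ l) * α₀ l)]
  have hCS : (∑ l, g l * (A₁ l * B₁ l - A₀ l * B₀ l)) ^ 2 ≤ H * 4 := by
    have e : ∀ l, g l * (A₁ l * B₁ l - A₀ l * B₀ l)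
        = (α₁ l * β₁ l - α₀ l * β₀ l) * (g l * (α₁ l * β₁ l + α₀ l * β₀ l)) := fun l => by
      rw [← sA₀, ← sA₁, ← sB₀, ← sB₁]; ring
    simp_rw [e]
    refine (sum_mul_sq_le_sq_mul_sq _ _ _).trans ?_
    refine mul_le_mul_of_nonneg_left ?_ (sum_nonneg fun l _ => sq_nonneg _)
    calc ∑ l, (g l * (α₁ l * β₁ l + α₀ l * β₀ l)) ^ 2
        ≤ ∑ l, (2 * (A₁ l * B₁ l) + 2 * (A₀ l * B₀ l)) := by
          refine sum_le_sum fun l _ => ?_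
          have hg2 : g l ^ 2 ≤ 1 := pow_le_one₀ (hg0 l) (hg1 l)
          rw [mul_pow, ← sA₀, ← sA₁, ← sB₀, ← sB₁]
          calc g l ^ 2 * (α₁ l * β₁ l + α₀ l * β₀ l) ^ 2
              ≤ 1 * (α₁ l * β₁ l + α₀ l * β₀ l) ^ 2 := by gcongr
            _ ≤ _ := by nlinarith [sq_nonneg (α₁ l * β₁ l - α₀ l * β₀ l)]
      _ = 4 := by rw [sum_add_distrib, ← mul_sum, ← mul_sum, h11, h00]; norm_num
  linarith

theorem revealed_nonneg_terms (a b : L → (ι → Bool) → ℝ)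
    (ha0 : ∀ l x, 0 ≤ a l x) (hb0 : ∀ l y, 0 ≤ b l y) (D : ι → Bool) (j : ι) :
    ∑ l, bias (fun u => a l (mask true D u)) j ^ 2
          * ((𝔼 v, b l (mask false D v)) / 𝔼 u, a l (mask true D u)) ≤ revealed a b D j ∧
    ∑ l, bias (fun v => b l (mask false D v)) j ^ 2
          * ((𝔼 u, a l (mask true D u)) / 𝔼 v, b l (mask false D v)) ≤ revealed a b D j := by
  have hA0 : ∀ l, 0 ≤ 𝔼 u, a l (mask true D u) := fun l => expect_nonneg fun u _ => ha0 _ _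
  have hB0 : ∀ l, 0 ≤ 𝔼 v, b l (mask false D v) := fun l => expect_nonneg fun u _ => hb0 _ _
  unfold revealed
  rw [sum_add_distrib]
  exact ⟨le_add_of_nonneg_right <| sum_nonneg fun l _ =>
      mul_nonneg (sq_nonneg _) (div_nonneg (hA0 l) (hB0 l)),
    le_add_of_nonneg_left <| sum_nonneg fun l _ =>
      mul_nonneg (sq_nonneg _) (div_nonneg (hB0 l) (hA0 l))⟩

theorem sum_fixMean_mul (hab : ∀ x y, ∑ l, a l x * b l y = 1) (D : ι → Bool) (j : ι)
    (s t : Bool) : ∑ l, fixMean (a l) true D j s * fixMean (b l) false D j t = 1 := by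
  unfold fixMean
  simp_rw [Fintype.expect_mul_expect]
  rw [← expect_sum_comm]
  simp_rw [← expect_sum_comm, hab]
  simp

/-- The fixed means do not depend on `D j`, but what is revealed does: with `j` on the first side
the first set is random there while the second omits `j`, and conversely. The two choices give
exactly the two Hellinger terms of the cut-and-paste bound. -/
theorem sq_fixMean_advantage_le
    (ha0 : ∀ l x, 0 ≤ a l x) (hb0 : ∀ l y, 0 ≤ b l y)
    (hab : ∀ x y, ∑ l, a l x * b l y = 1)
    {g : L → ℝ} (hg0 : ∀ l, 0 ≤ g l) (hg1 : ∀ l, g l ≤ 1) (D : ι → Bool) (j : ι) :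
    (∑ l, g l * (fixMean (a l) true D j true * fixMean (b l) false D j true
        - fixMean (a l) true D j false * fixMean (b l) false D j false)) ^ 2 ≤
      16 * (revealed a b (update D j true) j + revealed a b (update D j false) j) := by
  have hm : ∀ (f : (ι → Bool) → ℝ) (c s : Bool), (∀ x, 0 ≤ f x) → 0 ≤ fixMean f c D j s :=
    fun f c s h => expect_nonneg fun u _ => h _
  refine (sq_advantage_le_of_products _ _ _ _ g
    (fun l => hm _ _ _ (ha0 l)) (fun l => hm _ _ _ (ha0 l)) (fun l => hm _ _ _ (hb0 l))
    (fun l => hm _ _ _ (hb0 l)) hg0 hg1 (sum_fixMean_mul hab D j _ _)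
    (sum_fixMean_mul hab D j _ _) (sum_fixMean_mul hab D j _ _)
    (sum_fixMean_mul hab D j _ _)).trans ?_
  have r1 := (revealed_nonneg_terms a b ha0 hb0 (update D j true) j).1
  have r2 := (revealed_nonneg_terms a b ha0 hb0 (update D j false) j).2
  simp only [bias_mask_of_eq _ true (update D j true) j (by simp),
    expect_mask_of_eq _ true (update D j true) j (by simp),
    expect_mask_of_ne _ false (update D j true) j (by simp), fixMean_update] at r1
  simp only [bias_mask_of_eq _ false (update D j false) j (by simp),
    expect_mask_of_eq _ false (update D j false) j (by simp),
    expect_mask_of_ne _ true (update D j false) j (by simp), fixMean_update] at r2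
  linarith

/-- A protocol with few rectangles distinguishes disjoint from uniquely intersecting pairs of sets
with a small advantage only. -/
theorem sq_advantage_le [Nonempty ι]
    (ha0 : ∀ l x, 0 ≤ a l x) (ha1 : ∀ l x, a l x ≤ 1)
    (hb0 : ∀ l y, 0 ≤ b l y) (hb1 : ∀ l y, b l y ≤ 1)
    (hab : ∀ x y, ∑ l, a l x * b l y = 1)
    {g : L → ℝ} (hg0 : ∀ l, 0 ≤ g l) (hg1 : ∀ l, g l ≤ 1) :
    (𝔼 ω : Seed ι, ∑ l, g l * (a l (ω.fst true) * b l (ω.snd true)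
        - a l (ω.fst false) * b l (ω.snd false))) ^ 2 ≤
      64 * Real.log (Fintype.card L) / Fintype.card ι := by
  set adv : ι → (ι → Bool) → ℝ := fun j D =>
    ∑ l, g l * (fixMean (a l) true D j true * fixMean (b l) false D j true
        - fixMean (a l) true D j false * fixMean (b l) false D j false) with hadv
  have h1 : (𝔼 ω : Seed ι, ∑ l, g l * (a l (ω.fst true) * b l (ω.snd true)
        - a l (ω.fst false) * b l (ω.snd false))) = 𝔼 j, 𝔼 D, adv j D := by
    simp only [← univ_product_univ, expect_product, Seed.fst, Seed.snd]
    refine expect_congr rfl fun j _ => expect_congr rfl fun D _ => ?_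
    simp only [expect_sum_comm, ← mul_expect, expect_sub_distrib, hadv, fixMean,
      Fintype.expect_mul_expect]
  have h2 : ∀ j, 𝔼 D, adv j D ^ 2 ≤ 32 * 𝔼 D, revealed a b D j := by
    intro j
    calc 𝔼 D, adv j D ^ 2
        ≤ 𝔼 D, 16 * (revealed a b (update D j true) j + revealed a b (update D j false) j) :=
          expect_le_expect fun D _ => sq_fixMean_advantage_le ha0 hb0 hab hg0 hg1 D j
      _ = 32 * 𝔼 D, revealed a b D j := by
          -- Averaging over `D` averages the two values of `D j`, so their sum is twice the mean and
          -- `16` becomes `32`.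
          rw [expect_cube_split j fun D => revealed a b D j, ← mul_expect, expect_add_distrib]
          ring
  have jensen : ∀ {κ : Type _} [Fintype κ] [Nonempty κ] (f : κ → ℝ),
      (𝔼 i, f i) ^ 2 ≤ 𝔼 i, f i ^ 2 := by
    intro κ _ _ f
    have := expect_mul_sq_le_sq_mul_sq univ f fun _ => (1 : ℝ)
    simpa using this
  rw [h1]
  calc (𝔼 j, 𝔼 D, adv j D) ^ 2 ≤ 𝔼 j, (𝔼 D, adv j D) ^ 2 := jensen _
    _ ≤ 𝔼 j, 32 * 𝔼 D, revealed a b D j :=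
        expect_le_expect fun j _ => (jensen _).trans (h2 j)
    _ = (32 * 𝔼 D, ∑ j, revealed a b D j) / Fintype.card ι := by
        rw [Fintype.expect_eq_sum_div_card, ← mul_sum, expect_sum_comm]
    _ ≤ (32 * (2 * Real.log (Fintype.card L))) / Fintype.card ι := by
        gcongr
        exact expect_le univ_nonempty fun D _ => sum_revealed_le ha0 ha1 hb0 hb1 hab D
    _ = _ := by ring

end Disjointness

/-! ### From query algorithms to rectangles, and from disjointness to tasks. -/

/-- The inputs on which an algorithm makes at most `B` queries are partitioned into at most `2 ^ B`
rectangles on each of which the output is constant. -/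
theorem QueryAlg.exists_rectangles {n : ℕ} {O : Type} (dec : O → Bool) (B : ℕ)
    (A : QueryAlg n O) :
    ∃ (L : Type) (_ : Fintype L) (a b : L → Profile n → ℝ) (g : L → ℝ),
      Fintype.card L ≤ 2 ^ B ∧
      (∀ l P, 0 ≤ a l P) ∧ (∀ l P, a l P ≤ 1) ∧ (∀ l P, 0 ≤ b l P) ∧ (∀ l P, b l P ≤ 1) ∧
      (∀ l, 0 ≤ g l) ∧ (∀ l, g l ≤ 1) ∧
      (∀ PW PM, ∑ l, a l PW * b l PM = 1) ∧
      ∀ PW PM, A.numQueries PW PM ≤ B →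
        ∑ l, g l * (a l PW * b l PM) = if dec (A.run PW PM) = true then 1 else 0 := by
  induction B generalizing A with
  | zero =>
    cases A with
    | output o =>
      refine ⟨Unit, inferInstance, fun _ _ => 1, fun _ _ => 1,
        fun _ => if dec o = true then 1 else 0, ?_⟩
      refine ⟨by simp, by simp, by simp, by simp, by simp, ?_, ?_, by simp, ?_⟩
      · intro _; split_ifs <;> norm_num
      · intro _; split_ifs <;> norm_num
      · intro PW PM _; cases h : dec o <;> simp [QueryAlg.run, h]
    | askWomen q t f =>
      -- The tree is truncated here with a dummy leaf; no input reaches this node within the budget,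
      -- so its value is immaterial.
      refine ⟨Unit, inferInstance, fun _ _ => 1, fun _ _ => 1, fun _ => 0, ?_⟩
      refine ⟨by simp, by simp, by simp, by simp, by simp, by simp, by simp, by simp, ?_⟩
      intro PW PM h
      simp [QueryAlg.numQueries] at h
    | askMen q t f =>
      refine ⟨Unit, inferInstance, fun _ _ => 1, fun _ _ => 1, fun _ => 0, ?_⟩
      refine ⟨by simp, by simp, by simp, by simp, by simp, by simp, by simp, by simp, ?_⟩
      intro PW PM h
      simp [QueryAlg.numQueries] at h
  | succ B ih =>
    cases A with
    | output o =>
      refine ⟨Unit, inferInstance, fun _ _ => 1, fun _ _ => 1,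
        fun _ => if dec o = true then 1 else 0, ?_⟩
      refine ⟨by simp [Nat.one_le_two_pow], by simp, by simp, by simp, by simp, ?_, ?_, by simp, ?_⟩
      · intro _; split_ifs <;> norm_num
      · intro _; split_ifs <;> norm_num
      · intro PW PM _; cases h : dec o <;> simp [QueryAlg.run, h]
    | askWomen q t f =>
      obtain ⟨L₁, _, a₁, b₁, g₁, hL₁, ha₁, ha₁', hb₁, hb₁', hg₁, hg₁', hs₁, hr₁⟩ := ih t
      obtain ⟨L₂, _, a₂, b₂, g₂, hL₂, ha₂, ha₂', hb₂, hb₂', hg₂, hg₂', hs₂, hr₂⟩ := ih f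
      refine ⟨L₁ ⊕ L₂, inferInstance,
        Sum.elim (fun l P => if q P = true then a₁ l P else 0)
          (fun l P => if q P = true then 0 else a₂ l P),
        Sum.elim b₁ b₂, Sum.elim g₁ g₂, ?_⟩
      refine ⟨by rw [Fintype.card_sum, pow_succ]; omega, ?_, ?_, ?_, ?_, ?_, ?_, ?_, ?_⟩
      · rintro (l | l) P <;> simp only [Sum.elim_inl, Sum.elim_inr] <;> split_ifs <;> simp [*]
      · rintro (l | l) P <;> simp only [Sum.elim_inl, Sum.elim_inr] <;> split_ifs <;> simp [*]
      · rintro (l | l) P <;> simp [*]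
      · rintro (l | l) P <;> simp [*]
      · rintro (l | l) <;> simp [*]
      · rintro (l | l) <;> simp [*]
      · intro PW PM
        by_cases h : q PW = true <;> simp [h, hs₁, hs₂]
      · intro PW PM hq
        by_cases h : q PW = true
        · rw [QueryAlg.numQueries, if_pos h] at hq
          have := hr₁ PW PM (by omega)
          simpa [h, QueryAlg.run] using this
        · rw [QueryAlg.numQueries, if_neg h] at hq
          have := hr₂ PW PM (by omega)
          simpa [h, QueryAlg.run] using this
    | askMen q t f =>
      obtain ⟨L₁, _, a₁, b₁, g₁, hL₁, ha₁, ha₁', hb₁, hb₁', hg₁, hg₁', hs₁, hr₁⟩ := ih t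
      obtain ⟨L₂, _, a₂, b₂, g₂, hL₂, ha₂, ha₂', hb₂, hb₂', hg₂, hg₂', hs₂, hr₂⟩ := ih f
      refine ⟨L₁ ⊕ L₂, inferInstance, Sum.elim a₁ a₂,
        Sum.elim (fun l P => if q P = true then b₁ l P else 0)
          (fun l P => if q P = true then 0 else b₂ l P), Sum.elim g₁ g₂, ?_⟩
      refine ⟨by rw [Fintype.card_sum, pow_succ]; omega, ?_, ?_, ?_, ?_, ?_, ?_, ?_, ?_⟩
      · rintro (l | l) P <;> simp [*]
      · rintro (l | l) P <;> simp [*]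
      · rintro (l | l) P <;> simp only [Sum.elim_inl, Sum.elim_inr] <;> split_ifs <;> simp [*]
      · rintro (l | l) P <;> simp only [Sum.elim_inl, Sum.elim_inr] <;> split_ifs <;> simp [*]
      · rintro (l | l) <;> simp [*]
      · rintro (l | l) <;> simp [*]
      · intro PW PM
        by_cases h : q PM = true <;> simp [h, hs₁, hs₂]
      · intro PW PM hq
        by_cases h : q PM = true
        · rw [QueryAlg.numQueries, if_pos h] at hq
          have := hr₁ PW PM (by omega)
          simpa [h, QueryAlg.run] using this
        · rw [QueryAlg.numQueries, if_neg h] at hq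
          have := hr₂ PW PM (by omega)
          simpa [h, QueryAlg.run] using this

/-- An algorithm with few queries distinguishes disjoint from uniquely intersecting pairs of sets
with a small advantage only. -/
theorem QueryAlg.sq_advantage_le {n : ℕ} {O ι : Type} [Fintype ι] [DecidableEq ι] [Nonempty ι]
    (PW PM : (ι → Bool) → Profile n) (dec : O → Bool) (B : ℕ) (A : QueryAlg n O)
    (hA : ∀ PW PM, A.numQueries PW PM ≤ B) :
    (𝔼 ω : Seed ι, ((if dec (A.run (PW (ω.fst true)) (PM (ω.snd true))) = true then (1 : ℝ) else 0)
      - if dec (A.run (PW (ω.fst false)) (PM (ω.snd false))) = true then 1 else 0)) ^ 2 ≤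
      64 * (B * Real.log 2) / Fintype.card ι := by
  obtain ⟨L, _, a, b, g, hL, ha, ha', hb, hb', hg, hg', hs, hr⟩ := A.exists_rectangles dec B
  have key := StableMarriage.sq_advantage_le (a := fun l x => a l (PW x))
    (b := fun l y => b l (PM y)) (fun l x => ha l _) (fun l x => ha' l _) (fun l x => hb l _)
    (fun l x => hb' l _) (fun x y => hs _ _) hg hg'
  simp only [mul_sub, sum_sub_distrib, hr _ _ (hA _ _)] at key
  refine key.trans ?_
  have hne : Nonempty L := by
    by_contra h
    rw [not_nonempty_iff] at h
    simpa using hs (fun _ => Equiv.refl _) (fun _ => Equiv.refl _)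
  gcongr
  rw [← Real.log_pow]
  exact Real.log_le_log (by exact_mod_cast Fintype.card_pos) (by exact_mod_cast hL)

/-- Averaging over the random choices: some algorithm in the support does at least as well on a
finite family of inputs as the success probability demands. -/
theorem SolvesWithProb.exists_mem_support {n : ℕ} {O Ω : Type} [Fintype Ω] {p : ℝ} {T : Task n O}
    {D : PMF (QueryAlg n O)} (hD : SolvesWithProb p T D)
    (PW PM : Ω → Profile n) {M : ℝ} (hM : M < p * Fintype.card Ω) :
    ∃ A ∈ D.support, ∀ s : Ω → ℝ, (∀ ω, 0 ≤ s ω) →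
      (∀ ω, T (PW ω) (PM ω) (A.run (PW ω) (PM ω)) → 1 ≤ s ω) → M < ∑ ω, s ω := by
  classical
  by_contra hcon
  push Not at hcon
  have hcard : ∀ A ∈ D.support,
      ∑ ω, (if T (PW ω) (PM ω) (A.run (PW ω) (PM ω)) then (1 : ENNReal) else 0)
        ≤ ENNReal.ofReal M := by
    intro A hA
    obtain ⟨s, hs0, hs1, hsM⟩ := hcon A hA
    calc _ ≤ ∑ ω, ENNReal.ofReal (s ω) := by
          refine sum_le_sum fun ω _ => ?_
          split_ifs with h
          · simpa using hs1 ω h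
          · exact zero_le
      _ = ENNReal.ofReal (∑ ω, s ω) := (ENNReal.ofReal_sum_of_nonneg fun ω _ => hs0 ω).symm
      _ ≤ ENNReal.ofReal M := ENNReal.ofReal_le_ofReal hsM
  have hM0 : 0 ≤ M := by
    obtain ⟨A, hA⟩ := D.support_nonempty
    obtain ⟨s, hs0, -, hsM⟩ := hcon A hA
    exact (sum_nonneg fun ω _ => hs0 ω).trans hsM
  have hle : ENNReal.ofReal (p * Fintype.card Ω) ≤ ENNReal.ofReal M := by
    calc ENNReal.ofReal (p * Fintype.card Ω)
        = ∑ _ω : Ω, ENNReal.ofReal p := by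
          rw [ENNReal.ofReal_mul' (Nat.cast_nonneg _), ENNReal.ofReal_natCast, sum_const, card_univ,
            nsmul_eq_mul, mul_comm]
      _ ≤ ∑ ω, D.toOuterMeasure {A | T (PW ω) (PM ω) (A.run (PW ω) (PM ω))} :=
          sum_le_sum fun ω _ => hD _ _
      _ = ∑ ω, ∑' A, D A * (if T (PW ω) (PM ω) (A.run (PW ω) (PM ω)) then 1 else 0) := by
          refine sum_congr rfl fun ω _ => ?_
          rw [PMF.toOuterMeasure_apply]
          refine tsum_congr fun A => ?_
          simp [Set.indicator_apply]
      _ = ∑' A, D A * ∑ ω, (if T (PW ω) (PM ω) (A.run (PW ω) (PM ω)) then 1 else 0) := by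
          simp_rw [mul_sum]
          rw [Summable.tsum_finsetSum fun _ _ => ENNReal.summable]
      _ ≤ ∑' A, D A * ENNReal.ofReal M := by
          refine ENNReal.tsum_le_tsum fun A => ?_
          by_cases hA : A ∈ D.support
          · gcongr; exact hcard A hA
          · rw [PMF.mem_support_iff, not_not] at hA
            simp [hA]
      _ = ENNReal.ofReal M := by rw [ENNReal.tsum_mul_right, D.tsum_coe, one_mul]
  rw [ENNReal.ofReal_le_ofReal_iff hM0] at hle
  linarith

/-- A task to which unique disjointness reduces requires many queries. -/
theorem requiresQueries_of_reduction {n : ℕ} {O ι : Type} [Fintype ι] [DecidableEq ι] [Nonempty ι]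
    {p : ℝ} (hp : 1 / 2 < p) (hp1 : p ≤ 1) {T : Task n O}
    (PW PM : (ι → Bool) → Profile n) (dec : O → Bool)
    (hdisj : ∀ x y, (∀ i, ¬ (x i = true ∧ y i = true)) →
      ∀ o, T (PW x) (PM y) o → dec o = true)
    (hinter : ∀ x y i₀, (∀ i, (x i = true ∧ y i = true) ↔ i = i₀) →
      ∀ o, T (PW x) (PM y) o → dec o = false)
    {b : ℝ} (hb : b ≤ (2 * p - 1) ^ 2 / 128 * Fintype.card ι) : RequiresQueries p T b := by
  have hrand : ∀ D : PMF (QueryAlg n O), SolvesWithProb p T D →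
      ∃ A ∈ D.support, ∃ PW PM : Profile n, b ≤ (A.numQueries PW PM : ℝ) := by
    intro D hD
    by_contra hcon
    push Not at hcon
    set N : ℝ := (Fintype.card ι : ℝ) with hN
    have hNpos : 0 < N := by rw [hN]; exact_mod_cast Fintype.card_pos
    have hb0 : 0 < b := by
      obtain ⟨A, hA⟩ := D.support_nonempty
      exact (Nat.cast_nonneg _).trans_lt
        (hcon A hA (fun _ => Equiv.refl _) (fun _ => Equiv.refl _))
    set η : ℝ := √(64 * (b * Real.log 2) / N) with hη
    have hη1 : η < 2 * p - 1 := by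
      rw [hη, Real.sqrt_lt' (by linarith), div_lt_iff₀ hNpos]
      have hl := Real.log_two_lt_d9
      have : b * Real.log 2 < b * 1 := by
        apply mul_lt_mul_of_pos_left _ hb0; linarith
      have h3 : 0 ≤ (2 * p - 1) ^ 2 * N := by positivity
      nlinarith
    have hΩ : (0 : ℝ) < Fintype.card (Seed ι) := by exact_mod_cast Fintype.card_pos
    -- Both versions of every seed are inputs, so there are twice as many inputs as seeds; `η < 2 *
    -- p - 1` gives `1 + η < 2 * p`.
    obtain ⟨A, hA, hsum⟩ := hD.exists_mem_support (Ω := Bool × Seed ι)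
      (fun q => PW (q.2.fst q.1)) (fun q => PM (q.2.snd q.1))
      (M := (1 + η) * Fintype.card (Seed ι)) (by
        rw [Fintype.card_prod Bool, Fintype.card_bool]
        push_cast
        nlinarith)
    have hadv := A.sq_advantage_le PW PM dec ⌊b⌋₊ fun PW PM => Nat.le_floor (hcon A hA PW PM).le
    set d : Bool → Seed ι → ℝ := fun s ω =>
      if dec (A.run (PW (ω.fst s)) (PM (ω.snd s))) = true then 1 else 0 with hd
    have hd0 : ∀ s ω, 0 ≤ d s ω := fun s ω => by simp only [hd]; split_ifs <;> norm_num
    have hd1 : ∀ s ω, d s ω ≤ 1 := fun s ω => by simp only [hd]; split_ifs <;> norm_num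
    have hlow := hsum (fun q => if q.1 then 1 - d true q.2 else d false q.2)
      (by
        rintro ⟨s, ω⟩
        cases s
        · simpa using hd0 _ _
        · simpa using hd1 _ _)
      (by
        rintro ⟨s, ω⟩ hT
        cases s
        · have := hdisj _ _ ω.disjoint _ hT
          simp [hd, this]
        · have := hinter _ _ _ ω.fst_inter_snd _ hT
          simp [hd, this])
    rw [Fintype.sum_prod_type] at hlow
    simp only [Fintype.sum_bool, if_true, Bool.false_eq_true, if_false, ← sum_add_distrib] at hlow
    have hE : ∑ ω, (1 - d true ω + d false ω)
        = (1 - 𝔼 ω, (d true ω - d false ω)) * Fintype.card (Seed ι) := by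
      rw [Fintype.expect_eq_sum_div_card, sub_mul, div_mul_cancel₀ _ hΩ.ne', one_mul]
      simp only [sum_sub_distrib, sum_add_distrib, sum_const, card_univ, nsmul_eq_mul, mul_one]
      ring
    rw [hE] at hlow
    have h2 := lt_of_mul_lt_mul_right hlow hΩ.le
    have h3 : |𝔼 ω, (d true ω - d false ω)| ≤ η := by
      apply Real.abs_le_sqrt
      refine hadv.trans ?_
      have := Nat.floor_le hb0.le
      gcongr
    linarith [neg_abs_le (𝔼 ω, (d true ω - d false ω))]
  refine ⟨fun A hA => ?_, hrand⟩
  -- A deterministic algorithm is a point mass that succeeds with probability one.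
  obtain ⟨A', hA', h⟩ := hrand (PMF.pure A) fun PW PM => by
    rw [PMF.toOuterMeasure_pure_apply, if_pos (show A ∈ {A | T PW PM (A.run PW PM)} from hA PW PM)]
    exact ENNReal.ofReal_le_one.2 hp1
  rw [PMF.mem_support_pure_iff] at hA'
  exact hA' ▸ h

/-! ## The hard markets

Women and men are numbered below `n`, and the woman `v` is married to the man `v` in the marriage
under consideration. The women `i < k` and the men `k + j` with `j < k` may be mutually
interesting, depending on `X i j` and `Y i j`. The couples from `2 * k` on form a chain that shifts
by one as soon as a woman `k + j` loses her husband. -/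

/-- The priority of the man `b` on the list of the woman `a`; smaller is better. -/
def womanKey (n k : ℕ) (X : ℕ → ℕ → Bool) (a b : ℕ) : ℕ :=
  if a < k then
    if k ≤ b ∧ b < 2 * k ∧ X a (b - k) = true then 0 else if b = a then 1 else 2
  else if a < 2 * k then
    if b = a then 0 else if b = 2 * k then 1 else 2
  else
    if b = a then 0 else if b = a + 1 ∨ (a + 1 = n ∧ b < k) then 1 else 2

/-- The priority of the woman `a` on the list of the man `b`; smaller is better. -/
def manKey (n k : ℕ) (Y : ℕ → ℕ → Bool) (b a : ℕ) : ℕ :=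
  if b < k then
    if a = b then 0 else if a + 1 = n then 1 else 2
  else if b < 2 * k then
    if a < k ∧ Y a (b - k) = true then 0 else if a = b then 1 else 2
  else if b = 2 * k then
    if k ≤ a ∧ a < 2 * k then 0 else if a = b then 1 else 2
  else
    if a + 1 = b then 0 else if a = b then 1 else 2

/-- `f` is a permutation of the numbers below `n` without a pair that is blocking by strict
inequality of the priorities. -/
structure IsKeyStable (n k : ℕ) (X Y : ℕ → ℕ → Bool) (f : ℕ → ℕ) : Prop where
  surj : ∀ m < n, ∃ w < n, f w = m
  inj : ∀ v < n, ∀ w < n, f v = f w → v = w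
  no_block : ∀ w < n, ∀ w' < n, womanKey n k X w (f w') < womanKey n k X w (f w) →
    manKey n k Y (f w') w < manKey n k Y (f w') w' → False

namespace IsKeyStable

variable {n k : ℕ} {X Y : ℕ → ℕ → Bool} {f : ℕ → ℕ}

/-- A wife who is not his own must interest the man `k + j`, or else he blocks with the woman `k +
j`, who likes him best. He must interest her too, or else she blocks with the man `w`, who likes her
best. -/
theorem wife_of_middle (h : IsKeyStable n k X Y f) (hk : 2 * k < n) {j w : ℕ} (hj : j < k)
    (hw : w < n) (hf : f w = k + j) :
    w = k + j ∨ (w < k ∧ X w j = true ∧ Y w j = true) := by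
  have e : k + j - k = j := by omega
  by_contra hcon
  by_cases hwY : w < k ∧ Y w j = true
  · obtain ⟨w', hw', hf'⟩ := h.surj w hw
    have hb := h.no_block w hw w' hw'
    have hne : w' ≠ w := by rintro rfl; omega
    have hX : ¬ X w j = true := fun hX => hcon (Or.inr ⟨hwY.1, hX, hwY.2⟩)
    simp only [hf, hf', womanKey, manKey, hwY.1, e, hX] at hb
    grind
  · have hb := h.no_block (k + j) (by omega) w hw
    have hne : f (k + j) ≠ k + j := fun h' =>
      hcon (Or.inl (h.inj _ hw _ (by omega) (hf.trans h'.symm)))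
    simp only [hf, womanKey, manKey, e] at hb
    grind

/-- The man `i` likes the woman `i` best, and she places him above everyone except the middle men
that interest her. -/
theorem left_fixed (h : IsKeyStable n k X Y f) (hk : 2 * k < n) {i : ℕ} (hi : i < k)
    (hne : ∀ j < k, f i ≠ k + j) : f i = i := by
  by_contra hcon
  obtain ⟨w', hw', hf'⟩ := h.surj i (by omega)
  have hb := h.no_block i (by omega) w' hw'
  have h1 : ¬ (k ≤ f i ∧ f i < 2 * k ∧ X i (f i - k) = true) := fun h' =>
    hne (f i - k) (by omega) (by omega)
  have h2 : w' ≠ i := by rintro rfl; exact hcon hf'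
  simp only [hf', womanKey, manKey, hi, h1] at hb
  grind

/-- No middle man can leave his wife, so nobody starts the chain: along it, the only women whom a
man ranks above his own wife keep their husbands. -/
theorem eq_self_of_disjoint (h : IsKeyStable n k X Y f) (hk : 2 * k < n)
    (hXY : ∀ i j, ¬ (X i j = true ∧ Y i j = true)) : ∀ v < n, f v = v := by
  have hmid : ∀ v, k ≤ v → v < 2 * k → f v = v := by
    intro v h1 h2
    obtain ⟨w, hw, hf⟩ := h.surj v (by omega)
    rcases h.wife_of_middle hk (j := v - k) (by omega) hw (by omega) with h3 | h3
    · have : w = v := by omega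
      rwa [this] at hf
    · exact absurd h3.2 (hXY _ _)
  have hleft : ∀ v < k, f v = v := by
    intro v hv
    refine h.left_fixed hk hv fun j hj hf => ?_
    have := h.inj v (by omega) (k + j) (by omega) (hf.trans (hmid _ (by omega) (by omega)).symm)
    omega
  have hright : ∀ t, 2 * k + t < n → f (2 * k + t) = 2 * k + t := by
    intro t
    induction t with
    | zero =>
      intro ht
      by_contra hcon
      obtain ⟨w, hw, hf⟩ := h.surj (2 * k) (by omega)
      have hb := h.no_block (2 * k) (by omega) w hw
      have h1 : ¬ (k ≤ w ∧ w < 2 * k) := fun h' => by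
        have := hmid w h'.1 h'.2
        omega
      have h2 : w ≠ 2 * k := by rintro rfl; exact hcon hf
      simp only [hf, womanKey, manKey, h1] at hb
      grind
    | succ t ih =>
      intro ht
      have hprev := ih (by omega)
      by_contra hcon
      obtain ⟨w, hw, hf⟩ := h.surj (2 * k + (t + 1)) (by omega)
      have hb := h.no_block (2 * k + (t + 1)) (by omega) w hw
      have h1 : w ≠ 2 * k + t := by rintro rfl; omega
      have h2 : w ≠ 2 * k + (t + 1) := by rintro rfl; exact hcon hf
      simp only [hf, womanKey, manKey] at hb
      grind
  intro v hv
  by_cases h1 : v < k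
  · exact hleft v h1
  by_cases h2 : v < 2 * k
  · exact hmid v (by omega) h2
  · have := hright (v - 2 * k) (by omega)
    rwa [show 2 * k + (v - 2 * k) = v by omega] at this

end IsKeyStable

/-- The marriage in which the woman `i` and the man `k + j` are a couple and the chain is shifted;
all other couples are unchanged. -/
def shift (n k i j v : ℕ) : ℕ :=
  if v = i then k + j else if v = k + j then 2 * k else if v < 2 * k then v
  else if v + 1 = n then i else v + 1

variable {n k : ℕ} {X Y : ℕ → ℕ → Bool} {f : ℕ → ℕ}

theorem IsKeyStable.eq_shift (h : IsKeyStable n k X Y f) (hk : 2 * k < n) {i₀ j₀ : ℕ}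
    (hi₀ : i₀ < k) (hj₀ : j₀ < k)
    (hXY : ∀ i j, (X i j = true ∧ Y i j = true) ↔ i = i₀ ∧ j = j₀) :
    ∀ v < n, f v = shift n k i₀ j₀ v := by
  have hmid : ∀ j < k, j ≠ j₀ → f (k + j) = k + j := by
    intro j hj hne
    obtain ⟨w, hw, hf⟩ := h.surj (k + j) (by omega)
    rcases h.wife_of_middle hk hj hw hf with h3 | h3
    · rwa [h3] at hf
    · exact absurd ((hXY _ _).1 h3.2).2 hne
  have hi : f i₀ = k + j₀ := by
    obtain ⟨w, hw, hf⟩ := h.surj (k + j₀) (by omega)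
    rcases h.wife_of_middle hk hj₀ hw hf with h3 | h3
    · exfalso
      subst h3
      have hb := h.no_block i₀ (by omega) (k + j₀) hw
      have h1 : ¬ (k ≤ f i₀ ∧ f i₀ < 2 * k ∧ X i₀ (f i₀ - k) = true) := by
        rintro ⟨h1, h2, -⟩
        -- A middle husband of `i₀` would also be the husband of the woman with his own number,
        -- since all middle women keep their husbands in this case.
        have : f i₀ = f (f i₀) := by
          by_cases he : f i₀ - k = j₀
          · have : f i₀ = k + j₀ := by omega
            rw [this, hf]
          · have := hmid _ (by omega) he
            rw [show k + (f i₀ - k) = f i₀ by omega] at this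
            exact this.symm
        have := h.inj _ (by omega) _ (by omega) this
        omega
      have h2 := (hXY i₀ j₀).2 ⟨rfl, rfl⟩
      have e : k + j₀ - k = j₀ := by omega
      simp only [hf, womanKey, manKey, e, h2.1, h2.2, h1, hi₀] at hb
      grind
    · rwa [((hXY _ _).1 h3.2).1] at hf
  have hleft : ∀ v < k, v ≠ i₀ → f v = v := by
    intro v hv hne
    refine h.left_fixed hk hv fun j hj hf => ?_
    by_cases he : j = j₀
    · exact hne (h.inj _ (by omega) _ (by omega) (by rw [hf, hi, he]))
    · have := h.inj v (by omega) (k + j) (by omega) (hf.trans (hmid j hj he).symm)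
      omega
  -- The woman `k + j₀` has lost her husband and likes the man `2 * k` next; he prefers her to any
  -- wife outside the middle, and the other middle women are taken.
  have hj : f (k + j₀) = 2 * k := by
    by_contra hcon
    have h0 : f (k + j₀) ≠ k + j₀ := fun h' => by
      have := h.inj _ (by omega) _ (by omega) (h'.trans hi.symm)
      omega
    obtain ⟨w, hw, hf⟩ := h.surj (2 * k) (by omega)
    have hb := h.no_block (k + j₀) (by omega) w hw
    have h1 : ¬ (k ≤ w ∧ w < 2 * k) := fun h' => by
      by_cases he : w - k = j₀
      · exact hcon (by rw [← he, show k + (w - k) = w by omega, hf])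
      · have := hmid _ (by omega) he
        rw [show k + (w - k) = w by omega] at this
        omega
    simp only [hf, womanKey, manKey, h1] at hb
    grind
  have hchain : ∀ t, 2 * k + t < n → f (2 * k + t) ≠ 2 * k + t →
      2 * k + t + 1 < n → f (2 * k + t) = 2 * k + t + 1 := by
    intro t ht hne ht1
    by_contra hcon
    obtain ⟨w, hw, hf⟩ := h.surj (2 * k + t + 1) ht1
    have hb := h.no_block (2 * k + t) ht w hw
    have h1 : w ≠ 2 * k + t := by rintro rfl; exact hcon hf
    simp only [hf, womanKey, manKey] at hb
    grind
  have hright' : ∀ t, 2 * k + t < n → f (2 * k + t) ≠ 2 * k + t := by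
    intro t
    induction t with
    | zero =>
      intro ht hf
      have := h.inj _ ht _ (by omega) (hf.trans hj.symm)
      omega
    | succ t ih =>
      intro ht hf
      have h1 := hchain t (by omega) (ih (by omega)) ht
      have := h.inj _ ht (2 * k + t) (by omega) (hf.trans h1.symm)
      omega
  have hright : ∀ v, 2 * k ≤ v → v + 1 < n → f v = v + 1 := by
    intro v h1 h2
    have := hchain (v - 2 * k) (by omega) (hright' _ (by omega)) (by omega)
    rwa [show 2 * k + (v - 2 * k) = v by omega] at this
  -- By elimination: every other woman already has a different husband.
  have hlast : ∀ v, v + 1 = n → f v = i₀ := by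
    intro v hv
    obtain ⟨w, hw, hf⟩ := h.surj i₀ (by omega)
    have : w = v := by
      by_contra hne
      by_cases c1 : w < k
      · by_cases c : w = i₀
        · rw [c, hi] at hf; omega
        · have := hleft w c1 c
          omega
      · by_cases c2 : w < 2 * k
        · by_cases c : w = k + j₀
          · rw [c, hj] at hf; omega
          · have := hmid (w - k) (by omega) (by omega)
            rw [show k + (w - k) = w by omega] at this
            omega
        · have := hright w (by omega) (by omega)
          omega
    rwa [this] at hf
  intro v hv
  unfold shift
  split_ifs with c1 c2 c3 c4
  · rw [c1, hi]
  · rw [c2, hj]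
  · by_cases c : v < k
    · exact hleft v c c1
    · have := hmid (v - k) (by omega) (by omega)
      rwa [show k + (v - k) = v by omega] at this
  · exact hlast v c4
  · exact hright v (by omega) (by omega)

theorem shift_lt (hk : 2 * k < n) {i₀ j₀ : ℕ} (hi₀ : i₀ < k) (hj₀ : j₀ < k) {v : ℕ} (hv : v < n) :
    shift n k i₀ j₀ v < n := by
  unfold shift; split_ifs <;> omega

theorem shift_inj {i₀ j₀ : ℕ} (hi₀ : i₀ < k) (hj₀ : j₀ < k) {v w : ℕ} (hv : v < n)
    (hw : w < n) (h : shift n k i₀ j₀ v = shift n k i₀ j₀ w) : v = w := by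
  unfold shift at h; split_ifs at h <;> omega

theorem no_weak_block_self (hXY : ∀ i j, ¬ (X i j = true ∧ Y i j = true)) {w m : ℕ}
    (hne : m ≠ w) (h1 : womanKey n k X w m ≤ womanKey n k X w w)
    (h2 : manKey n k Y m w ≤ manKey n k Y m m) : False := by
  have := hXY w (m - k)
  unfold womanKey at h1
  unfold manKey at h2
  grind

/-- Excluding ties as well makes the marriage stable however the ties between keys are broken. -/
theorem no_weak_block_shift (hk : 2 * k < n) {i₀ j₀ : ℕ} (hi₀ : i₀ < k) (hj₀ : j₀ < k)
    (hXY : ∀ i j, (X i j = true ∧ Y i j = true) ↔ i = i₀ ∧ j = j₀) {w w' : ℕ}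
    (hw : w < n) (hw' : w' < n) (hne : w' ≠ w)
    (h1 : womanKey n k X w (shift n k i₀ j₀ w') ≤ womanKey n k X w (shift n k i₀ j₀ w))
    (h2 : manKey n k Y (shift n k i₀ j₀ w') w ≤ manKey n k Y (shift n k i₀ j₀ w') w') : False := by
  have e : k + j₀ - k = j₀ := by omega
  have h3 := hXY w (shift n k i₀ j₀ w' - k)
  obtain ⟨hX, hY⟩ := (hXY i₀ j₀).2 ⟨rfl, rfl⟩
  clear hXY
  have cases : ∀ v, (v = i₀ ∧ shift n k i₀ j₀ v = k + j₀) ∨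
      (v = k + j₀ ∧ shift n k i₀ j₀ v = 2 * k) ∨
      (v ≠ i₀ ∧ v ≠ k + j₀ ∧ v < 2 * k ∧ shift n k i₀ j₀ v = v) ∨
      (2 * k ≤ v ∧ v + 1 = n ∧ shift n k i₀ j₀ v = i₀) ∨
      (2 * k ≤ v ∧ v + 1 ≠ n ∧ shift n k i₀ j₀ v = v + 1) := by
    intro v
    unfold shift
    split_ifs <;> omega
  have c := cases w
  have c' := cases w'
  generalize shift n k i₀ j₀ w = s at *
  generalize shift n k i₀ j₀ w' = m at *
  clear cases
  unfold womanKey at h1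
  unfold manKey at h2
  rcases c with c | c | c | c | c <;> rcases c' with c' | c' | c' | c' | c' <;>
    grind (splits := 20)

/-! ### From keys to full preference lists. -/

/-- A preference list that sorts the other side by increasing keys. -/
def listOf {n : ℕ} (key : Fin n → ℕ) : Fin n ≃ Fin n := (Tuple.sort key).symm

theorem key_le_of_listOf_le {n : ℕ} {key : Fin n → ℕ} {b b' : Fin n}
    (h : listOf key b ≤ listOf key b') : key b ≤ key b' := by
  have := Tuple.monotone_sort key h
  simpa [listOf] using this

theorem listOf_lt_of_key_lt {n : ℕ} {key : Fin n → ℕ} {b b' : Fin n}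
    (h : key b < key b') : listOf key b < listOf key b' := by
  by_contra hcon
  exact absurd (key_le_of_listOf_le (not_lt.1 hcon)) (not_le.2 h)

/-- The indicator function of a set of pairs of numbers below `k`. -/
def extend {k : ℕ} (x : Fin k × Fin k → Bool) (i j : ℕ) : Bool :=
  if h : i < k ∧ j < k then x (⟨i, h.1⟩, ⟨j, h.2⟩) else false

theorem extend_and_extend {k : ℕ} {x y : Fin k × Fin k → Bool} {i j : ℕ} :
    (extend x i j = true ∧ extend y i j = true) ↔
      ∃ q : Fin k × Fin k, (q.1 : ℕ) = i ∧ (q.2 : ℕ) = j ∧ x q = true ∧ y q = true := by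
  unfold extend
  constructor
  · rintro ⟨h1, h2⟩
    by_cases h : i < k ∧ j < k
    · rw [dif_pos h] at h1 h2
      exact ⟨_, rfl, rfl, h1, h2⟩
    · rw [dif_neg h] at h1
      cases h1
  · rintro ⟨⟨a, b⟩, rfl, rfl, h1, h2⟩
    simp [h1, h2]

section Market

variable {n k : ℕ} (ρ : Fin n ≃ Fin n) (μ : Marriage n) (x y : Fin k × Fin k → Bool)

/-- The women's profile of the hard market, where the woman `w` has the number `ρ w` and the man
`m` has the number of his wife in `μ`. -/
def womenProfile : Profile n :=
  fun w => listOf fun m => womanKey n k (extend x) (ρ w) (ρ (μ.symm m))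

/-- The men's profile of the hard market. -/
def menProfile : Profile n :=
  fun m => listOf fun w => manKey n k (extend y) (ρ (μ.symm m)) (ρ w)

/-- The marriage `ν` in terms of numbers. -/
def numbered (ν : Marriage n) (v : ℕ) : ℕ :=
  if h : v < n then (ρ (μ.symm (ν (ρ.symm ⟨v, h⟩))) : ℕ) else v

variable {ρ μ x y}

theorem numbered_apply (ν : Marriage n) (w : Fin n) :
    numbered ρ μ ν (ρ w) = ρ (μ.symm (ν w)) := by
  simp [numbered]

theorem eq_of_numbered_eq {ν ν' : Marriage n}
    (h : ∀ v < n, numbered ρ μ ν v = numbered ρ μ ν' v) : ν = ν' := by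
  ext w
  have := h (ρ w) (ρ w).2
  rw [numbered_apply, numbered_apply, Fin.val_inj] at this
  rw [μ.symm.injective (ρ.injective this)]

theorem numbered_self {v : ℕ} (h : v < n) : numbered ρ μ μ v = v := by
  simp [numbered, h]

/-- Strict inequality of keys survives the breaking of ties, so uniqueness may be argued with keys
alone. -/
theorem IsStable.isKeyStable {ν : Marriage n}
    (h : IsStable (womenProfile ρ μ x) (menProfile ρ μ y) ν) :
    IsKeyStable n k (extend x) (extend y) (numbered ρ μ ν) where
  surj m hm := by
    refine ⟨ρ (ν.symm (μ (ρ.symm ⟨m, hm⟩))), Fin.is_lt _, ?_⟩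
    rw [numbered_apply]
    simp
  inj v hv w hw hvw := by
    simp only [numbered, hv, hw, dif_pos, Fin.val_inj, EmbeddingLike.apply_eq_iff_eq,
      Fin.mk.injEq] at hvw
    exact hvw
  no_block w hw w' hw' h1 h2 := by
    obtain ⟨a, ha⟩ := ρ.surjective ⟨w, hw⟩
    obtain ⟨a', ha'⟩ := ρ.surjective ⟨w', hw'⟩
    obtain rfl : (ρ a : ℕ) = w := by rw [ha]
    obtain rfl : (ρ a' : ℕ) = w' := by rw [ha']
    simp only [numbered_apply] at h1 h2
    refine h a (ν a') ⟨listOf_lt_of_key_lt h1, ?_⟩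
    unfold Prefers
    rw [Equiv.symm_apply_apply]
    exact listOf_lt_of_key_lt h2

theorem isStable_of_no_weak_block {ν : Marriage n}
    (h : ∀ w w' : Fin n, w' ≠ w →
      womanKey n k (extend x) (ρ w) (numbered ρ μ ν (ρ w'))
        ≤ womanKey n k (extend x) (ρ w) (numbered ρ μ ν (ρ w)) →
      manKey n k (extend y) (numbered ρ μ ν (ρ w')) (ρ w)
        ≤ manKey n k (extend y) (numbered ρ μ ν (ρ w')) (ρ w') → False) :
    IsStable (womenProfile ρ μ x) (menProfile ρ μ y) ν := by
  rintro w m ⟨h1, h2⟩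
  obtain ⟨w', rfl⟩ := ν.surjective m
  unfold Prefers at h1 h2
  rw [Equiv.symm_apply_apply] at h2
  have hne : w' ≠ w := by rintro rfl; exact lt_irrefl _ h1
  have h3 := key_le_of_listOf_le h1.le
  have h4 := key_le_of_listOf_le h2.le
  refine h w w' hne ?_ ?_
  · rw [numbered_apply, numbered_apply]; exact h3
  · rw [numbered_apply]; exact h4

theorem isStable_iff_of_disjoint (hk : 2 * k < n)
    (hxy : ∀ q, ¬ (x q = true ∧ y q = true)) (ν : Marriage n) :
    IsStable (womenProfile ρ μ x) (menProfile ρ μ y) ν ↔ ν = μ := by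
  have hXY : ∀ i j, ¬ (extend x i j = true ∧ extend y i j = true) := by
    intro i j h
    obtain ⟨q, -, -, hq⟩ := extend_and_extend.1 h
    exact hxy q hq
  constructor
  · intro h
    refine eq_of_numbered_eq (ρ := ρ) (μ := μ) fun v hv => ?_
    rw [numbered_self hv, h.isKeyStable.eq_self_of_disjoint hk hXY v hv]
  · rintro rfl
    refine isStable_of_no_weak_block fun w w' hne h1 h2 => ?_
    simp only [numbered_self (Fin.is_lt _)] at h1 h2
    exact no_weak_block_self hXY (fun h => hne (ρ.injective (Fin.ext h))) h1 h2

theorem exists_isStable_iff_of_inter (hk : 2 * k < n) {q₀ : Fin k × Fin k}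
    (hxy : ∀ q, (x q = true ∧ y q = true) ↔ q = q₀) :
    ∃ μ' : Marriage n,
      (∀ ν, IsStable (womenProfile ρ μ x) (menProfile ρ μ y) ν ↔ ν = μ') ∧
      (∀ w, 2 * k ≤ (ρ w : ℕ) → μ' w ≠ μ w) ∧
      #{w | μ w = μ' w} ≤ 2 * k := by
  obtain ⟨i₀, j₀⟩ := q₀
  have hXY : ∀ i j, (extend x i j = true ∧ extend y i j = true) ↔ i = i₀ ∧ j = j₀ := by
    intro i j
    rw [extend_and_extend]
    constructor
    · rintro ⟨q, rfl, rfl, hq⟩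
      rw [(hxy q).1 hq]
      exact ⟨rfl, rfl⟩
    · rintro ⟨rfl, rfl⟩
      exact ⟨(i₀, j₀), rfl, rfl, (hxy _).2 rfl⟩
  let s : Fin n → Fin n := fun v => ⟨shift n k i₀ j₀ v, shift_lt hk i₀.2 j₀.2 v.2⟩
  have hs : Injective s := fun v w h =>
    Fin.ext (shift_inj i₀.2 j₀.2 v.2 w.2 (Fin.mk.inj_iff.1 h))
  let e : Fin n ≃ Fin n := Equiv.ofBijective s (Finite.injective_iff_bijective.1 hs)
  let μ' : Marriage n := ((ρ.trans e).trans ρ.symm).trans μ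
  have hnum : ∀ v < n, numbered ρ μ μ' v = shift n k i₀ j₀ v := by
    intro v hv
    simp [numbered, hv, μ', e, s]
  have hne : ∀ w, 2 * k ≤ (ρ w : ℕ) → μ' w ≠ μ w := by
    intro w hw h
    have h1 := hnum (ρ w) (ρ w).2
    rw [numbered_apply, h, Equiv.symm_apply_apply] at h1
    have := i₀.2
    have := j₀.2
    unfold shift at h1
    split_ifs at h1 <;> omega
  refine ⟨μ', fun ν => ⟨fun h => ?_, ?_⟩, hne, ?_⟩
  · refine eq_of_numbered_eq (ρ := ρ) (μ := μ) fun v hv => ?_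
    rw [hnum v hv, h.isKeyStable.eq_shift hk i₀.2 j₀.2 hXY v hv]
  · rintro rfl
    refine isStable_of_no_weak_block fun w w' hww h1 h2 => ?_
    simp only [hnum _ (Fin.is_lt _)] at h1 h2
    exact no_weak_block_shift hk i₀.2 j₀.2 hXY (ρ w).2 (ρ w').2
      (fun h => hww (ρ.injective (Fin.ext h))) h1 h2
  · calc #{w | μ w = μ' w} ≤ #(range (2 * k)) := by
          refine card_le_card_of_injOn (fun w => (ρ w : ℕ)) ?_ ?_
          · intro w hw
            simp only [coe_filter, mem_univ, true_and, Set.mem_ofPred_eq] at hw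
            simp only [coe_range, Set.mem_Iio]
            by_contra h
            exact hne w (not_lt.1 h) hw.symm
          · intro w _ w' _ h
            exact ρ.injective (Fin.ext h)
      _ = 2 * k := card_range _

end Market

/-! ### From the hard markets to the tasks. -/

/-- A task requires many queries if a correct output tells whether the only stable marriage is `μ`
or one that has few couples in common with `μ`. -/
theorem requiresQueries_of_separates {p : ℝ} (hp : 1 / 2 < p) (hp1 : p ≤ 1) {n k : ℕ}
    (hk0 : 0 < k) (hk : 2 * k < n) (μ : Marriage n) (w₀ : Fin n) {O : Type} {T : Task n O}
    (dec : O → Prop)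
    (hμ : ∀ PW PM, (∀ ν, IsStable PW PM ν ↔ ν = μ) → ∀ o, T PW PM o → dec o)
    (hμ' : ∀ PW PM μ', (∀ ν, IsStable PW PM ν ↔ ν = μ') → μ' w₀ ≠ μ w₀ →
      #{w | μ w = μ' w} ≤ 2 * k → ∀ o, T PW PM o → ¬ dec o)
    {b : ℝ} (hb : b ≤ (2 * p - 1) ^ 2 / 128 * (k : ℝ) ^ 2) : RequiresQueries p T b := by
  classical
  have : Nonempty (Fin k) := ⟨⟨0, hk0⟩⟩
  -- The renumbering puts `w₀` at the head of the chain, so that she changes husbands whenever the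
  -- sets meet.
  let ρ : Fin n ≃ Fin n := Equiv.swap w₀ ⟨2 * k, hk⟩
  refine requiresQueries_of_reduction (ι := Fin k × Fin k) hp hp1 (womenProfile ρ μ)
    (menProfile ρ μ) (fun o => decide (dec o)) ?_ ?_ ?_
  · intro x y h o ho
    exact decide_eq_true (hμ _ _ (isStable_iff_of_disjoint hk h) o ho)
  · intro x y q₀ h o ho
    obtain ⟨μ', h1, h2, h3⟩ := exists_isStable_iff_of_inter (ρ := ρ) (μ := μ) hk h
    exact decide_eq_false (hμ' _ _ μ' h1 (h2 w₀ (by simp [ρ])) h3 o ho)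
  · refine hb.trans_eq ?_
    rw [Fintype.card_prod, Fintype.card_fin]
    push_cast
    ring

theorem distToStability_eq {n : ℕ} {PW PM : Profile n} {μ' : Marriage n}
    (h : ∀ ν, IsStable PW PM ν ↔ ν = μ') (μ : Marriage n) :
    distToStability PW PM μ = divorceDist μ μ' := by
  have : {k : ℕ | ∃ ν : Marriage n, IsStable PW PM ν ∧ divorceDist μ ν = k}
      = {divorceDist μ μ'} := by
    ext k
    simp [h, eq_comm]
  rw [distToStability, this, csInf_singleton]

theorem divorceDist_cast {n : ℕ} (μ μ' : Marriage n) :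
    (divorceDist μ μ' : ℝ) = n - (#{w | μ w = μ' w} : ℝ) := by
  rw [divorceDist, Nat.cast_sub]
  simpa using card_le_univ ({w | μ w = μ' w} : Finset (Fin n))

theorem divorceDist_triangle {n : ℕ} (μ ν μ' : Marriage n) :
    (divorceDist μ μ' : ℝ) ≤ divorceDist ν μ + divorceDist ν μ' := by
  simp only [divorceDist_cast]
  set F : Finset (Fin n) := {w | ν w = μ w} with hF
  set F' : Finset (Fin n) := {w | ν w = μ' w} with hF'
  have h := card_union_add_card_inter F F'
  have h1 := card_le_univ (F ∪ F')
  have h2 : #(F ∩ F') ≤ #{w | μ w = μ' w} := by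
    refine card_le_card fun w hw => ?_
    simp only [hF, hF', mem_inter, mem_filter, mem_univ, true_and] at hw ⊢
    exact hw.1.symm.trans hw.2
  rw [Fintype.card_fin] at h1
  have h3 : (#F : ℝ) + #F' ≤ n + #{w | μ w = μ' w} := by
    exact_mod_cast (by omega : #F + #F' ≤ n + #{w | μ w = μ' w})
  linarith

theorem inSomeStable_iff {n : ℕ} {PW PM : Profile n} {μ : Marriage n}
    (h : ∀ ν, IsStable PW PM ν ↔ ν = μ) (w m : Fin n) : InSomeStable PW PM w m ↔ μ w = m := by
  simp [InSomeStable, h]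

theorem inEveryStable_iff {n : ℕ} {PW PM : Profile n} {μ : Marriage n}
    (h : ∀ ν, IsStable PW PM ν ↔ ν = μ) (w m : Fin n) : InEveryStable PW PM w m ↔ μ w = m := by
  simp [InEveryStable, h]

/-- A list of pairs that fits two marriages consists of common couples, so it is short if the
marriages share few. -/
theorem IsPairList.le_card {n : ℕ} {ε : ℝ} {μ : Marriage n} {S : Finset (Fin n × Fin n)}
    (hS : IsPairList ε (fun w m => μ w = m) S) {μ' : Marriage n} (h : ∀ q ∈ S, μ' q.1 = q.2) :
    ε * n ≤ (#{w | μ' w = μ w} : ℝ) := by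
  refine hS.1.trans ?_
  refine Nat.cast_le.2 (card_le_card_of_injOn Prod.fst ?_ ?_)
  · intro q hq
    simp only [coe_filter, mem_univ, true_and, Set.mem_ofPred_eq]
    exact (h q hq).trans (hS.2 q hq).symm
  · intro q hq q' hq' he
    exact Prod.ext he (by rw [← hS.2 q hq, ← hS.2 q' hq', he])

theorem isPairList_graph {n : ℕ} {ε : ℝ} (hε : ε ≤ 1) (μ : Marriage n) :
    IsPairList ε (fun w m => μ w = m) (univ.image fun w => (w, μ w)) := by
  constructor
  · rw [card_image_of_injective _ fun w w' h => (Prod.ext_iff.1 h).1, card_univ, Fintype.card_fin]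
    exact mul_le_of_le_one_left (Nat.cast_nonneg _) hε
  · intro q hq
    obtain ⟨w, -, rfl⟩ := mem_image.1 hq
    rfl

/-- Finding pairs of the stable marriage is hard for every task that amounts to this whenever the
stable marriage is unique. -/
theorem requiresQueries_of_pairs {p : ℝ} (hp : 1 / 2 < p) (hp1 : p ≤ 1) {n k : ℕ}
    (hk0 : 0 < k) (hk : 2 * k < n) {ε : ℝ} (hε : ε ≤ 1) (hkε : 2 * (k : ℝ) < ε * n)
    {R : Profile n → Profile n → Fin n → Fin n → Prop}
    (hR : ∀ PW PM μ, (∀ ν, IsStable PW PM ν ↔ ν = μ) → ∀ w m, R PW PM w m ↔ μ w = m)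
    {b : ℝ} (hb : b ≤ (2 * p - 1) ^ 2 / 128 * (k : ℝ) ^ 2) :
    RequiresQueries (n := n) (O := Finset (Fin n × Fin n)) p (fun PW PM S =>
      (∃ S', IsPairList ε (R PW PM) S') → IsPairList ε (R PW PM) S) b := by
  have hR' : ∀ PW PM μ, (∀ ν, IsStable PW PM ν ↔ ν = μ) → R PW PM = fun w m => μ w = m :=
    fun PW PM μ h => by ext w m; exact hR PW PM μ h w m
  refine requiresQueries_of_separates hp hp1 hk0 hk (Equiv.refl _) ⟨0, by omega⟩
    (fun S => ∀ q ∈ S, (Equiv.refl (Fin n)) q.1 = q.2) ?_ ?_ hb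
  · intro PW PM h S hS
    rw [hR' PW PM _ h] at hS
    exact (hS ⟨_, isPairList_graph hε _⟩).2
  · intro PW PM μ' h _ hcard S hS hdec
    rw [hR' PW PM _ h] at hS
    have h1 := (hS ⟨_, isPairList_graph hε _⟩).le_card hdec
    have h2 : (#{w | (Equiv.refl (Fin n)) w = μ' w} : ℝ) ≤ 2 * k := by exact_mod_cast hcard
    linarith

/-- The size of the part of the market that carries the disjointness instance. -/
theorem exists_size {p : ℝ} (hp : 1 / 2 < p) {θ : ℝ} (hθ0 : 0 < θ) (hθ1 : θ ≤ 1) :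
    ∃ c : ℝ, 0 < c ∧ ∃ N : ℕ, ∀ n : ℕ, N ≤ n → ∃ k : ℕ, 0 < k ∧ 2 * k < n ∧
      2 * (k : ℝ) < θ * n ∧ c * (n : ℝ) ^ 2 ≤ (2 * p - 1) ^ 2 / 128 * (k : ℝ) ^ 2 := by
  have hp0 : 0 < 2 * p - 1 := by linarith
  refine ⟨(2 * p - 1) ^ 2 / 128 * (θ / 8) ^ 2, by positivity, ⌈8 / θ⌉₊, fun n hn => ?_⟩
  have hn8 : 8 ≤ θ * n := by
    have := (Nat.le_ceil _).trans (Nat.cast_le (α := ℝ).2 hn)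
    rw [div_le_iff₀ hθ0] at this
    linarith
  have hle := Nat.floor_le (show 0 ≤ θ * n / 4 by linarith)
  have hlt := Nat.lt_floor_add_one (θ * n / 4)
  set k := ⌊θ * n / 4⌋₊
  have hθn : θ * n ≤ n := mul_le_of_le_one_left (Nat.cast_nonneg _) hθ1
  refine ⟨k, ?_, ?_, by linarith, ?_⟩
  · exact_mod_cast (by linarith : (0 : ℝ) < k)
  · exact_mod_cast (by linarith : 2 * (k : ℝ) < n)
  · rw [mul_assoc, ← mul_pow]
    gcongr
    linarith

end StableMarriage

theorem theorem8 (p : ℝ) (hp : 1 / 2 < p) (hp1 : p ≤ 1) :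
    (∀ ε : ℝ, 0 ≤ ε → ε < 1 / 2 →
      ∃ c : ℝ, 0 < c ∧ ∃ N : ℕ, ∀ n : ℕ, N ≤ n →
        RequiresQueries p (findApproxStable n ε) (c * (n : ℝ) ^ 2)) ∧
    (∀ ε : ℝ, 0 ≤ ε → ε < 1 →
      ∃ c : ℝ, 0 < c ∧ ∃ N : ℕ, ∀ n : ℕ, N ≤ n → ∀ μ : Marriage n,
        RequiresQueries p (distinguishStable ε μ) (c * (n : ℝ) ^ 2)) ∧
    (∃ c : ℝ, 0 < c ∧ ∃ N : ℕ, ∀ n : ℕ, N ≤ n → ∀ w m : Fin n,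
        RequiresQueries p (decideInSome w m) (c * (n : ℝ) ^ 2) ∧
        RequiresQueries p (decideInEvery w m) (c * (n : ℝ) ^ 2)) ∧
    (∀ ε : ℝ, 0 < ε → ε ≤ 1 →
      ∃ c : ℝ, 0 < c ∧ ∃ N : ℕ, ∀ n : ℕ, N ≤ n →
        RequiresQueries p (findPairsInSome n ε) (c * (n : ℝ) ^ 2) ∧
        RequiresQueries p (findPairsInEvery n ε) (c * (n : ℝ) ^ 2)) := by
  refine ⟨fun ε hε0 hε1 => ?_, fun ε hε0 hε1 => ?_, ?_, fun ε hε0 hε1 => ?_⟩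
  -- Then the two candidate stable marriages are more than `2 * ε * n` apart, and no output is
  -- within `ε * n` of both.
  · obtain ⟨c, hc, N, h⟩ := exists_size hp (θ := 1 - 2 * ε) (by linarith) (by linarith)
    refine ⟨c, hc, N, fun n hn => ?_⟩
    obtain ⟨k, hk0, hk, hkθ, hb⟩ := h n hn
    refine requiresQueries_of_separates hp hp1 hk0 hk (Equiv.refl _) ⟨0, by omega⟩
      (fun ν => (divorceDist ν (Equiv.refl _) : ℝ) ≤ ε * n) ?_ ?_ hb
    · intro PW PM h ν hν
      rwa [findApproxStable, IsApproxStable, distToStability_eq h] at hν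
    · intro PW PM μ' h _ hcard ν hν hdec
      rw [findApproxStable, IsApproxStable, distToStability_eq h] at hν
      have h1 := divorceDist_triangle (Equiv.refl (Fin n)) ν μ'
      rw [divorceDist_cast (Equiv.refl (Fin n)) μ'] at h1
      have h2 := Nat.cast_le (α := ℝ).2 hcard
      push_cast at h2
      linarith
  · obtain ⟨c, hc, N, h⟩ := exists_size hp (θ := 1 - ε) (by linarith) (by linarith)
    refine ⟨c, hc, N, fun n hn μ => ?_⟩
    obtain ⟨k, hk0, hk, hkθ, hb⟩ := h n hn
    refine requiresQueries_of_separates hp hp1 hk0 hk μ ⟨0, by omega⟩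
      (fun a => a = true) ?_ ?_ hb
    · intro PW PM h a ha
      exact ha.1 ((h μ).2 rfl)
    · intro PW PM μ' h _ hcard a ha
      have hu : IsUnstable ε PW PM μ := by
        rw [IsUnstable, distToStability_eq h, divorceDist_cast]
        have h2 := Nat.cast_le (α := ℝ).2 hcard
        push_cast at h2
        linarith
      simp [ha.2 hu]
  · obtain ⟨c, hc, N, h⟩ := exists_size hp (θ := 1) (by norm_num) le_rfl
    refine ⟨c, hc, N, fun n hn w m => ?_⟩
    obtain ⟨k, hk0, hk, -, hb⟩ := h n hn
    constructor
    -- The transposition is merely a convenient marriage that contains the given pair.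
    · refine requiresQueries_of_separates hp hp1 hk0 hk (Equiv.swap w m) w
        (fun a => a = true) ?_ ?_ hb
      · intro PW PM h a ha
        exact ha.2 ((inSomeStable_iff h w m).2 (Equiv.swap_apply_left w m))
      · intro PW PM μ' h hne _ a ha hdec
        rw [Equiv.swap_apply_left] at hne
        exact hne ((inSomeStable_iff h w m).1 (ha.1 hdec))
    · refine requiresQueries_of_separates hp hp1 hk0 hk (Equiv.swap w m) w
        (fun a => a = true) ?_ ?_ hb
      · intro PW PM h a ha
        exact ha.2 ((inEveryStable_iff h w m).2 (Equiv.swap_apply_left w m))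
      · intro PW PM μ' h hne _ a ha hdec
        rw [Equiv.swap_apply_left] at hne
        exact hne ((inEveryStable_iff h w m).1 (ha.1 hdec))
  · obtain ⟨c, hc, N, h⟩ := exists_size hp hε0 hε1
    refine ⟨c, hc, N, fun n hn => ?_⟩
    obtain ⟨k, hk0, hk, hkθ, hb⟩ := h n hn
    exact ⟨requiresQueries_of_pairs hp hp1 hk0 hk hε1 hkθ
        (fun _ _ _ h w m => inSomeStable_iff h w m) hb,
      requiresQueries_of_pairs hp hp1 hk0 hk hε1 hkθ
        (fun _ _ _ h w m => inEveryStable_iff h w m) hb⟩
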